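/- Let $\mathcal{P}$ be a finite set of prime numbers, let $k\geq 1$ be an integer, and let $(\alpha_n)_{n\ge 1}$ be a sequence of real numbers with $\lim_{n\to\infty} n\alpha_n/\ln(n)=\infty$. For every $n\geq 1$ let $X=X^{(n)}$ be a $\mathbb{Z}^{n\times n}$-valued random matrix with independent, not necessarily identically distributed, entries such that $\mathbb{P}(X_{i,j}\equiv y \bmod p)\leq 1-\alpha_n$ for all $i,j\leq n$, all $p\in\mathcal{P}$ and all $y\in\mathbb{Z}/p\mathbb{Z}$. For every $n\geq k$ let $B=B^{(n)}\in\mathbb{Z}^{n\times k}$ be a deterministic matrix whose reduction modulo $p$ has rank $k$ over $\mathbb{F}_p$ for every $p\in\mathcal{P}$. Let $\widetilde{W}=(B, XB,\ldots,X^{n-1}B)$, an $n\times nk$ matrix, and let $\operatorname{coker}(\widetilde{W})=\mathbb{Z}^n/\widetilde{W}(\mathbb{Z}^{nk})$, which is a $\mathbb{Z}[x]$-module through $xv = Xv$. Then, for every finite $\mathbb{Z}[x]$-module $N$ such that all prime divisors of $\#N$ lie in $\mathcal{P}$, $$\lim_{n\to\infty}\mathbb{E}\bigl[\#\operatorname{Sur}_{\mathbb{Z}[x]}(\operatorname{coker}(\widetilde{W}),N)\bigr]=(\#N)^{-k},$$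 where $\operatorname{Sur}_{\mathbb{Z}[x]}(M,N)$ denotes the set of surjective $\mathbb{Z}[x]$-module morphisms from $M$ to $N$. -/

import Mathlib

open Polynomial MeasureTheory ProbabilityTheory Filter Topology
open scoped ENNReal

/-- A `ℤ`-valued random variable `Y` is `α`-balanced mod `P` if `ℙ(Y ≡ y mod p) ≤ 1 - α` for all
`p ∈ P` and all `y ∈ ℤ/pℤ`. -/
def IsBalancedMod {Ω : Type*} [MeasurableSpace Ω] (μ : Measure Ω) (P : Finset ℕ) (α : ℝ)
    (Y : Ω → ℤ) : Prop :=
  ∀ p ∈ P, ∀ y : ZMod p, μ.real {ω | (Y ω : ZMod p) = y} ≤ 1 - α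

/-- The `n × nk` matrix `(B, X B, …, X ^ (n - 1) B)`, with columns indexed by pairs `(j, r)`: the
column `(j, r)` is the `r`-th column of `X ^ j * B`, where `j` runs over `0, …, n - 1`. -/
def walkMatrix {n k : ℕ} (X : Matrix (Fin n) (Fin n) ℤ) (B : Matrix (Fin n) (Fin k) ℤ) :
    Matrix (Fin n) (Fin n × Fin k) ℤ :=
  Matrix.of fun i jr => (X ^ (jr.1 : ℕ) * B) i jr.2

/-- The image `W(ℤ^{nk}) ⊆ ℤ^n` of the walk matrix. -/
def walkRange {n k : ℕ} (X : Matrix (Fin n) (Fin n) ℤ) (B : Matrix (Fin n) (Fin k) ℤ) :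
    Submodule ℤ (Fin n → ℤ) :=
  LinearMap.range (walkMatrix X B).mulVecLin

theorem pow_mul_col_mem_walkRange {n k : ℕ} (X : Matrix (Fin n) (Fin n) ℤ)
    (B : Matrix (Fin n) (Fin k) ℤ) (j : ℕ) (r : Fin k) :
    (X ^ j * B).col r ∈ walkRange X B := by
  have hlt : ∀ i < n, (X ^ i * B).col r ∈ walkRange X B := by
    intro i hi
    refine ⟨Pi.single (⟨i, hi⟩, r) 1, ?_⟩
    ext a
    simp [walkMatrix, Matrix.col]
  rcases Nat.eq_zero_or_pos n with rfl | hn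
  · have : (X ^ j * B).col r = 0 := Subsingleton.elim _ _
    rw [this]
    exact zero_mem _
  · have hmonic := X.charpoly_monic
    have hpow : X ^ j = aeval X (Polynomial.X ^ j %ₘ X.charpoly : ℤ[X]) :=
      Matrix.pow_eq_aeval_mod_charpoly X j
    have hdeg : (Polynomial.X ^ j %ₘ X.charpoly : ℤ[X]).natDegree < n := by
      have h := natDegree_modByMonic_lt (Polynomial.X ^ j : ℤ[X]) hmonic (by
        intro h1
        have := X.charpoly_natDegree_eq_dim
        rw [h1] at this
        simp at this
        omega)
      rwa [X.charpoly_natDegree_eq_dim, Fintype.card_fin] at h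
    rw [hpow, aeval_eq_sum_range' hdeg, Matrix.sum_mul]
    have hcol : (∑ i ∈ Finset.range n,
        ((Polynomial.X ^ j %ₘ X.charpoly : ℤ[X]).coeff i • X ^ i) * B).col r =
        ∑ i ∈ Finset.range n,
          (Polynomial.X ^ j %ₘ X.charpoly : ℤ[X]).coeff i • (X ^ i * B).col r := by
      ext a
      simp only [Matrix.col_apply, Matrix.sum_apply, Finset.sum_apply, Pi.smul_apply,
        Matrix.smul_mul, Matrix.smul_apply]
    rw [hcol]
    exact Submodule.sum_mem _ fun i hi =>
      Submodule.smul_mem _ _ (hlt i (Finset.mem_range.1 hi))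

/-- The image of the walk matrix is stable under `X`, by the Cayley-Hamilton theorem. -/
theorem walkRange_mem_invtSubmodule {n k : ℕ} (X : Matrix (Fin n) (Fin n) ℤ)
    (B : Matrix (Fin n) (Fin k) ℤ) :
    walkRange X B ∈ (Algebra.lsmul ℤ ℤ (Fin n → ℤ) X.mulVecLin).invtSubmodule := by
  rw [Module.End.mem_invtSubmodule]
  rintro _ ⟨c, rfl⟩
  have h : (Algebra.lsmul ℤ ℤ (Fin n → ℤ) X.mulVecLin) ((walkMatrix X B).mulVecLin c) =
      ∑ jr : Fin n × Fin k, c jr • (X ^ ((jr.1 : ℕ) + 1) * B).col jr.2 := by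
    have hX : X * walkMatrix X B = Matrix.of fun i (jr : Fin n × Fin k) =>
        (X ^ ((jr.1 : ℕ) + 1) * B) i jr.2 := by
      ext i jr
      simp only [Matrix.of_apply, pow_succ', Matrix.mul_assoc, Matrix.mul_apply (M := X)]
      rfl
    change X.mulVec ((walkMatrix X B).mulVec c) = _
    rw [Matrix.mulVec_mulVec, hX]
    ext a
    simp only [Matrix.mulVec, dotProduct, Matrix.of_apply, Finset.sum_apply, Pi.smul_apply,
      Matrix.col_apply, smul_eq_mul]
    exact Finset.sum_congr rfl fun _ _ => mul_comm _ _
  rw [Submodule.mem_comap, h]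
  exact Submodule.sum_mem _ fun jr _ =>
    Submodule.smul_mem _ _ (pow_mul_col_mem_walkRange X B _ _)

/-- `coker(W) = ℤ^n / W(ℤ^{nk})` as a `ℤ[x]`-module. Here `Module.AEval' X.mulVecLin` is `ℤ^n`
with the `ℤ[x]`-module structure `x • v = X v`, and the submodule divided out is the image of the
walk matrix, seen as a `ℤ[x]`-submodule. -/
abbrev WalkCoker {n k : ℕ} (X : Matrix (Fin n) (Fin n) ℤ) (B : Matrix (Fin n) (Fin k) ℤ) : Type :=
  Module.AEval' X.mulVecLin ⧸
    (Module.AEval.mapSubmodule ℤ (Fin n → ℤ) X.mulVecLin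
      ⟨walkRange X B, walkRange_mem_invtSubmodule X B⟩)

/-- The set of surjective `R`-module morphisms from `M` to `N`. -/
def moduleSur (R M N : Type*) [Semiring R] [AddCommMonoid M] [AddCommMonoid N] [Module R M]
    [Module R N] : Set (M →ₗ[R] N) :=
  {f | Function.Surjective f}

/-!
The idea is a first-moment computation with finite Fourier analysis on `N`. A morphism from the
cokernel to `N` is a vector `F : Fin n → N` (the images of the basis vectors) which is annihilated
by the transpose of `B` and satisfies `∑ i, X i j • F i = x • F j` for every column `j`; it is
surjective exactly when the entries of `F` generate `N` (`encard_moduleSur_walkCoker`). The expected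
number of surjections is therefore the sum, over the generating vectors annihilated by `B`, of a
product over the independent columns of the probabilities of these equations.

The law of a column sum `∑ i, X i j • F i` is computed by Fourier inversion (`card_mul_prob_eq`).
By the balancedness of the entries, a character `χ` contributes at most `exp (-c α)` to the power of
the number of `i` with `χ (F i) ≠ 1` (`norm_prod_integral_char_le`). If no proper subgroup contains
all but few of the `F i`, each column equation thus has probability `(#N)⁻¹` up to a factor
`1 + o(1 / n)`, which is where `n α_n / log n → ∞` enters. Since `B` has full rank modulo every
prime divisor of `#N`, exactly `(#N) ^ (n - k)` vectors are annihilated by `B`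
(`card_ker_transposeAct_div`), and together such vectors contribute the limit `(#N) ^ (-k)`.

The other generating vectors are negligible. Such a vector is spread out in a proper subgroup `H`
(`IsSpread`, `exists_isSpread`), with a positive but small number `s` of entries outside `H`. By an
averaging argument some character trivial on `H` is nontrivial at `s / 2` or more of these entries
(`exists_char_offCount`), so that the probability of the `n` column equations is at most
`(#H) ^ (-n)` times `exp (-n / (2 m)) + exp (-c' n α s)` up to a constant, where `m = #N`
(`prob_forall_column_le`). Summing over the vectors with the generating function
`∑ F, r ^ s(F) = (#H + r (m - #H)) ^ n` (`sum_pow_offCount`) shows that the total tends to zero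
(`sum_prob_not_isSpread_top_le`), because `n exp (-c' n α) → 0`. The two regimes are combined in
`abs_sum_prob_sub_le`.
-/

/-! ### Characters of a finite abelian group -/

section Characters

variable {G : Type*} [AddCommGroup G]

/-- The kernel of a complex character, as a subgroup. -/
def charKer (χ : AddChar G ℂ) : AddSubgroup G where
  carrier := {g | χ g = 1}
  zero_mem' := χ.map_zero_eq_one
  add_mem' {a b} ha hb := by
    simp only [Set.mem_ofPred_eq] at *
    rw [χ.map_add_eq_mul, ha, hb, one_mul]
  neg_mem' {a} ha := by
    simp only [Set.mem_ofPred_eq] at *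
    rw [χ.map_neg_eq_inv, ha, inv_one]

@[simp] lemma mem_charKer {χ : AddChar G ℂ} {g : G} : g ∈ charKer χ ↔ χ g = 1 := Iff.rfl

open Classical in
/-- The number of indices `i` for which `F i` lies outside the subgroup `H`. -/
noncomputable def offCount {ι : Type*} [Fintype ι] (H : AddSubgroup G) (F : ι → G) : ℕ :=
  (Finset.univ.filter fun i => F i ∉ H).card

variable [Finite G]

lemma exists_char_gap (G : Type*) [AddCommGroup G] [Finite G] :
    ∃ d : ℝ, 0 < d ∧ ∀ (χ : AddChar G ℂ) (g : G), χ g ≠ 1 → d ≤ ‖1 - χ g‖ := by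
  obtain ⟨x, hx⟩ := Finite.exists_min
    (fun x : AddChar G ℂ × G => if x.1 x.2 = 1 then (1 : ℝ) else ‖1 - x.1 x.2‖)
  refine ⟨_, ?_, fun χ g h => (hx (χ, g)).trans_eq (if_neg h)⟩
  split_ifs with h
  · exact one_pos
  · exact norm_pos_iff.2 (sub_ne_zero.2 (Ne.symm h))

omit [Finite G] in
/-- The relation between the values of a character on the multiples of `g` only involves the
multiple modulo some prime divisor of the order of the group. -/
lemma exists_prime_dvd_of_char_zsmul_eq_one {χ : AddChar G ℂ} {g : G} (h : χ g ≠ 1) :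
    ∃ p : ℕ, p.Prime ∧ p ∣ Nat.card G ∧ ∀ y : ℤ, χ (y • g) = 1 → (p : ℤ) ∣ y := by
  obtain ⟨a, ha⟩ := Int.subgroup_cyclic ((charKer χ).comap (zmultiplesHom G g))
  have key : ∀ y : ℤ, χ (y • g) = 1 ↔ a ∣ y := by
    intro y
    rw [← Int.mem_zmultiples_iff, AddSubgroup.zmultiples_eq_closure, ← ha]
    rfl
  have hone : a.natAbs ≠ 1 := by
    intro h1
    apply h
    have := (key 1).2 (Int.isUnit_iff_natAbs_eq.2 h1).dvd
    simpa using this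
  obtain ⟨p, hp, hpa⟩ := Nat.exists_prime_and_dvd hone
  have hpa' : (p : ℤ) ∣ a := Int.natCast_dvd.2 hpa
  refine ⟨p, hp, ?_, fun y hy => hpa'.trans ((key y).1 hy)⟩
  have : a ∣ (Nat.card G : ℤ) := by
    rw [← key, natCast_zsmul, card_nsmul_eq_zero', χ.map_zero_eq_one]
  exact Int.natCast_dvd_natCast.1 (hpa'.trans this)

/-- For nonzero `q`, at least half of all characters are nontrivial at `q`, as `∑ χ, χ q = 0`. -/
lemma card_le_two_mul_card_char_ne_one [Fintype G] {q : G} (hq : q ≠ 0) :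
    (Fintype.card G : ℝ) ≤
      2 * ((Finset.univ.filter fun χ : AddChar G ℂ => χ q ≠ 1).card : ℝ) := by
  classical
  have h0 : ∑ χ : AddChar G ℂ, χ q = 0 := AddChar.sum_apply_eq_zero_iff_ne_zero.2 hq
  have h1 : ∑ χ : AddChar G ℂ, (1 - (χ q).re) = Fintype.card G := by
    rw [Finset.sum_sub_distrib, ← Complex.re_sum, h0]
    simp
  rw [← h1, Finset.card_filter]
  push_cast
  rw [Finset.mul_sum]
  refine Finset.sum_le_sum fun χ _ => ?_
  split_ifs with h
  · have := (abs_le.1 ((Complex.abs_re_le_norm (χ q)).trans_eq (χ.norm_apply q))).1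
    linarith
  · rw [not_not.1 h]
    simp

lemma exists_char_offCount {ι : Type*} [Fintype ι] (F : ι → G) :
    ∃ χ : AddChar G ℂ, offCount (⊥ : AddSubgroup G) F ≤ 2 * offCount (charKer χ) F := by
  classical
  cases nonempty_fintype G
  by_contra! hlt
  have hcard : ∑ χ : AddChar G ℂ, 2 * (offCount (charKer χ) F : ℝ) <
      ∑ χ : AddChar G ℂ, (offCount (⊥ : AddSubgroup G) F : ℝ) :=
    Finset.sum_lt_sum_of_nonempty ⟨0, Finset.mem_univ _⟩ fun χ _ => by exact_mod_cast hlt χ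
  rw [Finset.sum_const, Finset.card_univ, AddChar.card_eq, nsmul_eq_mul] at hcard
  refine hcard.not_ge ?_
  have hswap : ∑ χ : AddChar G ℂ, 2 * (offCount (charKer χ) F : ℝ) =
      ∑ i, 2 * ((Finset.univ.filter fun χ : AddChar G ℂ => χ (F i) ≠ 1).card : ℝ) := by
    simp only [offCount, Finset.card_filter, ← Finset.mul_sum, mem_charKer]
    push_cast
    rw [Finset.sum_comm]
  rw [hswap, offCount, Finset.card_filter]
  push_cast
  rw [Finset.mul_sum]
  refine Finset.sum_le_sum fun i _ => ?_
  split_ifs with h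
  · simp
  · simpa using card_le_two_mul_card_char_ne_one (q := F i) (by simpa using h)

end Characters

/-! ### The distribution of a random integer combination of group elements -/

section Column

variable {G : Type*} [AddCommGroup G] [Finite G]
  {Ω : Type*} [MeasurableSpace Ω] {μ : Measure Ω} [IsProbabilityMeasure μ]

lemma integrable_char_zsmul (χ : AddChar G ℂ) (g : G) {Y : Ω → ℤ} (hY : Measurable Y) :
    Integrable (fun ω => χ (Y ω • g)) μ :=
  Integrable.of_bound
    (((Measurable.of_discrete (f := fun y : ℤ => χ (y • g))).comp hY).aestronglyMeasurable) 1
    (Eventually.of_forall fun _ => (χ.norm_apply _).le)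

/-- After a rotation making the expectation of `χ (Y • g)` a nonnegative real, the values of
`χ (Y • g)` within distance `d / 2` of `1` all coincide, so that `Y` is off a fixed residue
class modulo `p`, and the real part at most `1 - d ^ 2 / 8`, with probability at least `α`. -/
lemma norm_integral_char_le {P : Finset ℕ} (hP : ∀ p : ℕ, p.Prime → p ∣ Nat.card G → p ∈ P)
    {α : ℝ} {Y : Ω → ℤ} (hY : Measurable Y) (hbal : IsBalancedMod μ P α Y)
    {d : ℝ} (hd0 : 0 < d) (hd : ∀ (χ : AddChar G ℂ) (g : G), χ g ≠ 1 → d ≤ ‖1 - χ g‖)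
    {χ : AddChar G ℂ} {g : G} (h : χ g ≠ 1) :
    ‖∫ ω, χ (Y ω • g) ∂μ‖ ≤ Real.exp (-(d ^ 2 / 8 * α)) := by
  obtain ⟨u, hu, huφ⟩ := RCLike.exists_norm_eq_mul_self (∫ ω, χ (Y ω • g) ∂μ)
  obtain ⟨p, hp, hpG, hpy⟩ := exists_prime_dvd_of_char_zsmul_eq_one h
  have hnorm : ∀ y : ℤ, ‖u * χ (y • g)‖ = 1 := fun y => by rw [norm_mul, hu, χ.norm_apply, one_mul]
  set S : Set ℤ := {y | ‖1 - u * χ (y • g)‖ < d / 2} with hS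
  have hSp : ∃ y₀ : ℤ, ∀ y ∈ S, (y : ZMod p) = (y₀ : ZMod p) := by
    by_cases hne : S.Nonempty
    · obtain ⟨y₀, hy₀⟩ := hne
      refine ⟨y₀, fun y hy => ?_⟩
      rw [← sub_eq_zero, ← Int.cast_sub, ZMod.intCast_zmod_eq_zero_iff_dvd]
      refine hpy _ ?_
      by_contra hne1
      have hgap := hd χ _ hne1
      have heq : ‖1 - χ ((y - y₀) • g)‖ = ‖u * χ (y₀ • g) - u * χ (y • g)‖ := by
        have : u * χ (y₀ • g) - u * χ (y • g) = u * χ (y₀ • g) * (1 - χ ((y - y₀) • g)) := by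
          rw [mul_sub, mul_one, mul_assoc, ← χ.map_add_eq_mul, ← add_smul, add_sub_cancel]
        rw [this, norm_mul, hnorm, one_mul]
      have htri : ‖u * χ (y₀ • g) - u * χ (y • g)‖ ≤
          ‖1 - u * χ (y • g)‖ + ‖1 - u * χ (y₀ • g)‖ := by
        have : u * χ (y₀ • g) - u * χ (y • g) =
          (1 - u * χ (y • g)) - (1 - u * χ (y₀ • g)) := by ring
        rw [this]
        exact norm_sub_le _ _
      have h1 : ‖1 - u * χ (y • g)‖ < d / 2 := hy
      have h2 : ‖1 - u * χ (y₀ • g)‖ < d / 2 := hy₀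
      linarith
    · exact ⟨0, fun y hy => absurd ⟨y, hy⟩ hne⟩
  obtain ⟨y₀, hy₀⟩ := hSp
  have hSmeas : MeasurableSet (Y ⁻¹' S) := hY (MeasurableSet.of_discrete)
  have hprob : μ.real (Y ⁻¹' S) ≤ 1 - α :=
    (measureReal_mono (s₂ := {ω | (Y ω : ZMod p) = (y₀ : ZMod p)}) fun ω hω => hy₀ _ hω).trans
      (hbal p (hP p hp hpG) _)
  have hre : ∀ y : ℤ, (u * χ (y • g)).re ≤ (1 - d ^ 2 / 8) + S.indicator (fun _ => d ^ 2 / 8) y := by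
    intro y
    have hsq : ‖1 - u * χ (y • g)‖ ^ 2 = 2 - 2 * (u * χ (y • g)).re := by
      have h1 : (u * χ (y • g)).re ^ 2 + (u * χ (y • g)).im ^ 2 = 1 := by
        have := Complex.sq_norm (u * χ (y • g))
        rw [hnorm, Complex.normSq_apply] at this
        linarith
      rw [Complex.sq_norm, Complex.normSq_apply, Complex.sub_re, Complex.sub_im, Complex.one_re,
        Complex.one_im]
      linarith
    by_cases hy : y ∈ S
    · rw [Set.indicator_of_mem hy]
      have := (Complex.re_le_norm (u * χ (y • g))).trans_eq (hnorm y)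
      linarith
    · rw [Set.indicator_of_notMem hy]
      have h1 : d / 2 ≤ ‖1 - u * χ (y • g)‖ := not_lt.1 hy
      have h2 : (d / 2) ^ 2 ≤ ‖1 - u * χ (y • g)‖ ^ 2 := by gcongr
      linarith
  have hint : Integrable (fun ω => u * χ (Y ω • g)) μ := (integrable_char_zsmul χ g hY).const_mul u
  have hφ : ‖∫ ω, χ (Y ω • g) ∂μ‖ = ∫ ω, (u * χ (Y ω • g)).re ∂μ := by
    have h1 : (∫ ω, (u * χ (Y ω • g)) ∂μ).re = ∫ ω, (u * χ (Y ω • g)).re ∂μ :=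
      (integral_re (𝕜 := ℂ) hint).symm
    rw [← h1, integral_const_mul, ← huφ]
    rfl
  have hindint : Integrable (fun ω => (Y ⁻¹' S).indicator (fun _ => d ^ 2 / 8) ω) μ :=
    (integrable_const _).indicator hSmeas
  calc ‖∫ ω, χ (Y ω • g) ∂μ‖ = ∫ ω, (u * χ (Y ω • g)).re ∂μ := hφ
    _ ≤ ∫ ω, ((1 - d ^ 2 / 8) + (Y ⁻¹' S).indicator (fun _ => d ^ 2 / 8) ω) ∂μ := by
        refine integral_mono hint.re ((integrable_const _).add hindint) fun ω => hre (Y ω)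
    _ = (1 - d ^ 2 / 8) + μ.real (Y ⁻¹' S) * (d ^ 2 / 8) := by
        rw [integral_add (integrable_const _) hindint, integral_indicator_const _ hSmeas]
        simp
    _ ≤ (1 - d ^ 2 / 8) + (1 - α) * (d ^ 2 / 8) := by gcongr
    _ = -(d ^ 2 / 8 * α) + 1 := by ring
    _ ≤ _ := Real.add_one_le_exp _

variable {ι : Type*} [Fintype ι]

lemma norm_prod_integral_char_le {P : Finset ℕ}
    (hP : ∀ p : ℕ, p.Prime → p ∣ Nat.card G → p ∈ P)
    {α : ℝ} {Y : ι → Ω → ℤ} (hY : ∀ i, Measurable (Y i)) (hbal : ∀ i, IsBalancedMod μ P α (Y i))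
    {d : ℝ} (hd0 : 0 < d) (hd : ∀ (χ : AddChar G ℂ) (g : G), χ g ≠ 1 → d ≤ ‖1 - χ g‖)
    (χ : AddChar G ℂ) (F : ι → G) :
    ‖∏ i, ∫ ω, χ (Y i ω • F i) ∂μ‖ ≤
      Real.exp (-(d ^ 2 / 8 * α) * offCount (charKer χ) F) := by
  classical
  have hexp : Real.exp (-(d ^ 2 / 8 * α) * offCount (charKer χ) F) =
      ∏ i, if F i ∉ charKer χ then Real.exp (-(d ^ 2 / 8 * α)) else 1 := by
    rw [Finset.prod_ite, Finset.prod_const_one, mul_one, Finset.prod_const, ← Real.exp_nat_mul,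
      mul_comm, offCount]
  rw [hexp, norm_prod]
  refine Finset.prod_le_prod (fun _ _ => norm_nonneg _) fun i _ => ?_
  split_ifs with h
  · refine (norm_integral_le_integral_norm _).trans ?_
    simp [χ.norm_apply]
  · exact norm_integral_char_le hP (hY i) (hbal i) hd0 hd h

/-- Fourier inversion on `G` for the law of `∑ i, Y i • F i`. -/
lemma card_mul_prob_eq {Y : ι → Ω → ℤ} (hY : ∀ i, Measurable (Y i))
    (hind : iIndepFun Y μ) (F : ι → G) (v : G) :
    ((Nat.card G * μ.real {ω | ∑ i, Y i ω • F i = v} : ℝ) : ℂ) =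
      ∑ χ : AddChar G ℂ, χ (-v) * ∏ i, ∫ ω, χ (Y i ω • F i) ∂μ := by
  classical
  cases nonempty_fintype G
  have hYall : Measurable fun ω i => Y i ω := measurable_pi_iff.2 hY
  have hmeas : MeasurableSet {ω | ∑ i, Y i ω • F i = v} :=
    hYall (MeasurableSet.of_discrete (s := {y : ι → ℤ | ∑ i, y i • F i = v}))
  have h1 : ∀ χ : AddChar G ℂ, χ (-v) * ∏ i, ∫ ω, χ (Y i ω • F i) ∂μ =
      ∫ ω, χ (∑ i, Y i ω • F i - v) ∂μ := by
    intro χ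
    rw [← hind.integral_fun_prod_comp (f := fun i y => χ (y • F i))
      (fun i => (hY i).aemeasurable)
      (fun i => (Measurable.of_discrete).aestronglyMeasurable), ← integral_const_mul]
    refine integral_congr_ae (Eventually.of_forall fun ω => ?_)
    dsimp only
    rw [sub_eq_neg_add, χ.map_add_eq_mul]
    exact congrArg _ (map_prod χ.toMonoidHom (fun i => Multiplicative.ofAdd (Y i ω • F i)) _).symm
  simp_rw [h1]
  rw [← integral_finsetSum]
  · have h2 : ∀ ω, ∑ χ : AddChar G ℂ, χ (∑ i, Y i ω • F i - v) =
        {ω | ∑ i, Y i ω • F i = v}.indicator (fun _ => (Fintype.card G : ℂ)) ω := by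
      intro ω
      rw [AddChar.sum_apply_eq_ite]
      simp [Set.indicator_apply, sub_eq_zero]
    simp_rw [h2]
    rw [integral_indicator_const _ hmeas]
    simp [Nat.card_eq_fintype_card, mul_comm]
  · intro χ _
    exact Integrable.of_bound (((Measurable.of_discrete
      (f := fun y : ι → ℤ => χ (∑ i, y i • F i - v))).comp hYall).aestronglyMeasurable) 1
      (Eventually.of_forall fun _ => (χ.norm_apply _).le)

end Column

/-! ### Vectors spread out in a subgroup -/

section Spread

variable {G : Type*} [AddCommGroup G] {ι : Type*} [Fintype ι]

open Classical in
/-- The vector `F` is `t`-spread in the subgroup `H` if for every proper subgroup `H'` of `H`, at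
least `t` of its entries lie in `H` but not in `H'`. For `H = ⊤` this says that `F` still generates
`G` after the removal of fewer than `t` entries. Entries outside `H` are allowed. -/
def IsSpread (t : ℝ) (H : AddSubgroup G) (F : ι → G) : Prop :=
  ∀ H' < H, t ≤ ((Finset.univ.filter fun i => F i ∈ H ∧ F i ∉ H').card : ℝ)

lemma IsSpread.le_offCount_charKer {t : ℝ} {H : AddSubgroup G} {F : ι → G} (h : IsSpread t H F)
    {χ : AddChar G ℂ} (hχ : ¬ H ≤ charKer χ) : t ≤ offCount (charKer χ) F := by
  classical
  refine (h (H ⊓ charKer χ) (inf_lt_left.2 hχ)).trans ?_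
  refine Nat.cast_le.2 (Finset.card_le_card fun i hi => ?_)
  simp only [Finset.mem_filter, AddSubgroup.mem_inf, not_and] at hi ⊢
  exact ⟨hi.1, hi.2.2 hi.2.1⟩

/-- Every vector is spread out in a subgroup containing most of its entries: take `H` minimal among
the subgroups with at most `(#G - #H) * t` entries outside. -/
lemma exists_isSpread [Finite G] {t : ℝ} (ht : 0 ≤ t) (F : ι → G) :
    ∃ H : AddSubgroup G, IsSpread t H F ∧ (offCount H F : ℝ) ≤ Nat.card G * t := by
  classical
  let Q : AddSubgroup G → Prop := fun H =>
    (offCount H F : ℝ) ≤ ((Nat.card G : ℝ) - Nat.card H) * t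
  have htop : Q ⊤ := by simp [Q, offCount]
  obtain ⟨H, hH⟩ := exists_minimal_of_wellFoundedLT Q ⟨⊤, htop⟩
  refine ⟨H, fun H' hlt => ?_, hH.prop.trans ?_⟩
  · have hnot : ¬ Q H' := fun hQ => hH.not_prop_of_lt hlt hQ
    have h1 : ((Nat.card G : ℝ) - Nat.card H') * t < offCount H' F := not_le.1 hnot
    have h2 : (offCount H F : ℝ) ≤ ((Nat.card G : ℝ) - Nat.card H) * t := hH.prop
    have h3 : (Nat.card H' : ℝ) + 1 ≤ Nat.card H := by
      exact_mod_cast Set.ncard_lt_ncard (s := (H' : Set G)) (t := H) hlt (Set.toFinite _)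
    have h4 : offCount H' F =
        offCount H F + (Finset.univ.filter fun i => F i ∈ H ∧ F i ∉ H').card := by
      rw [offCount, offCount, ← Finset.card_union_of_disjoint]
      · congr 1
        ext i
        simp only [Finset.mem_filter, Finset.mem_univ, true_and, Finset.mem_union]
        have : F i ∈ H' → F i ∈ H := fun h => hlt.le h
        tauto
      · rw [Finset.disjoint_filter]
        tauto
    have h5 : (offCount H' F : ℝ) = offCount H F +
        ((Finset.univ.filter fun i => F i ∈ H ∧ F i ∉ H').card : ℝ) := by exact_mod_cast h4
    nlinarith
  · have : (0 : ℝ) ≤ Nat.card H := Nat.cast_nonneg _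
    nlinarith

end Spread

section CharactersOfQuotient

variable {G : Type*} [AddCommGroup G]

lemma exists_quotient_char {H : AddSubgroup G} {χ : AddChar G ℂ} (h : H ≤ charKer χ) :
    ∃ ψ : AddChar (G ⧸ H) ℂ, ψ.compAddMonoidHom (QuotientAddGroup.mk' H) = χ := by
  refine ⟨AddChar.toAddMonoidHomEquiv.symm
    (QuotientAddGroup.lift H (AddChar.toAddMonoidHomEquiv χ) fun g hg => h hg), ?_⟩
  ext g
  rfl

variable [Finite G] {ι : Type*} [Fintype ι]

open Classical in
/-- The characters trivial on `H` are those of `G ⧸ H`, and one of them is nontrivial at no fewer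
than half of the entries outside `H`. -/
lemma sum_exp_offCount_le (H : AddSubgroup G) (F : ι → G) {κ : ℝ} (hκ : 0 ≤ κ) :
    ∑ χ ∈ Finset.univ.filter (fun χ : AddChar G ℂ => H ≤ charKer χ),
      Real.exp (-κ * offCount (charKer χ) F) ≤
        H.index - (1 - Real.exp (-κ * (offCount H F / 2))) := by
  have hcard : ((Finset.univ.filter fun χ : AddChar G ℂ => H ≤ charKer χ).card : ℝ) ≤ H.index := by
    cases nonempty_fintype (G ⧸ H)
    rw [AddSubgroup.index, Nat.card_eq_fintype_card, ← AddChar.card_eq, Nat.cast_le]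
    refine (Finset.card_le_card (t := Finset.univ.image fun ψ : AddChar (G ⧸ H) ℂ =>
      ψ.compAddMonoidHom (QuotientAddGroup.mk' H)) fun χ hχ => ?_).trans Finset.card_image_le
    obtain ⟨ψ, hψ⟩ := exists_quotient_char (Finset.mem_filter.1 hχ).2
    exact Finset.mem_image.2 ⟨ψ, Finset.mem_univ _, hψ⟩
  obtain ⟨ψ, hψ⟩ := exists_char_offCount fun i => QuotientAddGroup.mk' H (F i)
  set χ₀ := ψ.compAddMonoidHom (QuotientAddGroup.mk' H) with hχ₀
  have hmem : χ₀ ∈ Finset.univ.filter fun χ : AddChar G ℂ => H ≤ charKer χ := by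
    refine Finset.mem_filter.2 ⟨Finset.mem_univ _, fun g hg => ?_⟩
    have : (QuotientAddGroup.mk' H) g = 0 := (QuotientAddGroup.eq_zero_iff g).2 hg
    rw [mem_charKer, hχ₀, AddChar.compAddMonoidHom_apply, this, ψ.map_zero_eq_one]
  have hoff : (offCount H F : ℝ) / 2 ≤ offCount (charKer χ₀) F := by
    have h1 : offCount (⊥ : AddSubgroup (G ⧸ H)) (fun i => QuotientAddGroup.mk' H (F i)) =
        offCount H F := by
      simp [offCount, AddSubgroup.mem_bot]
    have h2 : offCount (charKer ψ) (fun i => QuotientAddGroup.mk' H (F i)) =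
        offCount (charKer χ₀) F := rfl
    rw [h1, h2] at hψ
    have : (offCount H F : ℝ) ≤ 2 * offCount (charKer χ₀) F := by exact_mod_cast hψ
    linarith
  rw [← Finset.sum_erase_add _ _ hmem]
  have h1 : Real.exp (-κ * offCount (charKer χ₀) F) ≤ Real.exp (-κ * (offCount H F / 2)) := by
    rw [Real.exp_le_exp]
    nlinarith
  have h2 : ∑ χ ∈ (Finset.univ.filter fun χ : AddChar G ℂ => H ≤ charKer χ).erase χ₀,
      Real.exp (-κ * offCount (charKer χ) F) ≤
        ((Finset.univ.filter fun χ : AddChar G ℂ => H ≤ charKer χ).card : ℝ) - 1 := by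
    refine (Finset.sum_le_card_nsmul _ _ 1 fun χ _ => ?_).trans ?_
    · rw [Real.exp_le_one_iff]
      have : (0 : ℝ) ≤ offCount (charKer χ) F := Nat.cast_nonneg _
      nlinarith
    · rw [nsmul_eq_mul, mul_one, Finset.cast_card_erase_of_mem hmem]
  linarith

end CharactersOfQuotient

/-! ### Column probabilities -/

section ColumnBounds

variable {G : Type*} [AddCommGroup G] [Finite G]
  {Ω : Type*} [MeasurableSpace Ω] {μ : Measure Ω} [IsProbabilityMeasure μ]
  {ι : Type*} [Fintype ι] {P : Finset ℕ} {α : ℝ} {Y : ι → Ω → ℤ} {d t : ℝ} {F : ι → G}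

/-- All nontrivial characters contribute little, so that `∑ i, Y i • F i` is nearly uniform. -/
lemma abs_card_mul_prob_sub_one_le (hP : ∀ p : ℕ, p.Prime → p ∣ Nat.card G → p ∈ P)
    (hY : ∀ i, Measurable (Y i)) (hind : iIndepFun Y μ) (hbal : ∀ i, IsBalancedMod μ P α (Y i))
    (hd0 : 0 < d) (hd : ∀ (χ : AddChar G ℂ) (g : G), χ g ≠ 1 → d ≤ ‖1 - χ g‖)
    (hα : 0 ≤ α) (hF : IsSpread t ⊤ F) (v : G) :
    |Nat.card G * μ.real {ω | ∑ i, Y i ω • F i = v} - 1| ≤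
      Nat.card G * Real.exp (-(d ^ 2 / 8 * α) * t) := by
  classical
  cases nonempty_fintype G
  have h0 : ((Nat.card G * μ.real {ω | ∑ i, Y i ω • F i = v} - 1 : ℝ) : ℂ) =
      ∑ χ ∈ Finset.univ.erase (0 : AddChar G ℂ),
        χ (-v) * ∏ i, ∫ ω, χ (Y i ω • F i) ∂μ := by
    rw [Complex.ofReal_sub, card_mul_prob_eq hY hind,
      ← Finset.sum_erase_add _ _ (Finset.mem_univ (0 : AddChar G ℂ))]
    simp
  rw [← Real.norm_eq_abs, ← Complex.norm_real, h0]
  refine (norm_sum_le _ _).trans ((Finset.sum_le_card_nsmul _ _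
    (Real.exp (-(d ^ 2 / 8 * α) * t)) fun χ hχ => ?_).trans ?_)
  · rw [norm_mul, χ.norm_apply, one_mul]
    refine (norm_prod_integral_char_le hP hY hbal hd0 hd χ F).trans ?_
    rw [Real.exp_le_exp]
    have hker : ¬ ⊤ ≤ charKer χ := by
      intro htop
      apply (Finset.mem_erase.1 hχ).1
      ext g
      simpa using! htop (AddSubgroup.mem_top g)
    have h1 := hF.le_offCount_charKer hker
    have h2 : 0 ≤ d ^ 2 / 8 * α := by positivity
    nlinarith
  · rw [nsmul_eq_mul]
    gcongr
    rw [Nat.card_eq_fintype_card, ← AddChar.card_eq]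
    exact Finset.card_le_univ _

/-- Characters nontrivial on `H` contribute little, and `sum_exp_offCount_le` bounds the others. -/
lemma card_mul_prob_le (hP : ∀ p : ℕ, p.Prime → p ∣ Nat.card G → p ∈ P)
    (hY : ∀ i, Measurable (Y i)) (hind : iIndepFun Y μ) (hbal : ∀ i, IsBalancedMod μ P α (Y i))
    (hd0 : 0 < d) (hd : ∀ (χ : AddChar G ℂ) (g : G), χ g ≠ 1 → d ≤ ‖1 - χ g‖)
    (hα : 0 ≤ α) {H : AddSubgroup G} (hF : IsSpread t H F) (v : G) :
    Nat.card G * μ.real {ω | ∑ i, Y i ω • F i = v} ≤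
      H.index - (1 - Real.exp (-(d ^ 2 / 8 * α) * (offCount H F / 2))) +
        Nat.card G * Real.exp (-(d ^ 2 / 8 * α) * t) := by
  classical
  cases nonempty_fintype G
  have hκ : 0 ≤ d ^ 2 / 8 * α := by positivity
  have hnn : (0 : ℝ) ≤ Nat.card G * μ.real {ω | ∑ i, Y i ω • F i = v} := by positivity
  have h0 : Nat.card G * μ.real {ω | ∑ i, Y i ω • F i = v} =
      ‖∑ χ : AddChar G ℂ, χ (-v) * ∏ i, ∫ ω, χ (Y i ω • F i) ∂μ‖ := by
    rw [← card_mul_prob_eq hY hind, Complex.norm_real, Real.norm_of_nonneg hnn]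
  have h1 : Nat.card G * μ.real {ω | ∑ i, Y i ω • F i = v} ≤
      ∑ χ : AddChar G ℂ, Real.exp (-(d ^ 2 / 8 * α) * offCount (charKer χ) F) := by
    rw [h0]
    refine (norm_sum_le _ _).trans (Finset.sum_le_sum fun χ _ => ?_)
    rw [norm_mul, χ.norm_apply, one_mul]
    exact norm_prod_integral_char_le hP hY hbal hd0 hd χ F
  refine h1.trans ?_
  rw [← Finset.sum_filter_add_sum_filter_not _ (fun χ : AddChar G ℂ => H ≤ charKer χ)]
  refine add_le_add (sum_exp_offCount_le H F hκ) ?_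
  refine (Finset.sum_le_card_nsmul _ _
    (Real.exp (-(d ^ 2 / 8 * α) * t)) fun χ hχ => ?_).trans ?_
  · rw [Real.exp_le_exp]
    have h1 := hF.le_offCount_charKer (Finset.mem_filter.1 hχ).2
    nlinarith
  · rw [nsmul_eq_mul]
    gcongr
    rw [Nat.card_eq_fintype_card, ← AddChar.card_eq]
    exact Finset.card_le_univ _

lemma prob_le_exp (hP : ∀ p : ℕ, p.Prime → p ∣ Nat.card G → p ∈ P)
    (hY : ∀ i, Measurable (Y i)) (hind : iIndepFun Y μ) (hbal : ∀ i, IsBalancedMod μ P α (Y i))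
    (hd0 : 0 < d) (hd : ∀ (χ : AddChar G ℂ) (g : G), χ g ≠ 1 → d ≤ ‖1 - χ g‖)
    (hα : 0 ≤ α) {H : AddSubgroup G} (hF : IsSpread t H F) (v : G) :
    μ.real {ω | ∑ i, Y i ω • F i = v} ≤
      (Nat.card H : ℝ)⁻¹ *
        Real.exp (-((1 - Real.exp (-(d ^ 2 / 8 * α) * (offCount H F / 2))) / Nat.card G) +
          Nat.card G * Real.exp (-(d ^ 2 / 8 * α) * t)) := by
  have hκ : 0 ≤ d ^ 2 / 8 * α := by positivity
  have hmain := card_mul_prob_le hP hY hind hbal hd0 hd hα hF v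
  have hprod : (Nat.card H : ℝ) * H.index = Nat.card G := by exact_mod_cast H.card_mul_index
  have hH : (0 : ℝ) < Nat.card H := Nat.cast_pos.2 Nat.card_pos
  have hD : (1 : ℝ) ≤ H.index := by
    exact_mod_cast Nat.one_le_iff_ne_zero.2 AddSubgroup.index_ne_zero_of_finite
  have hm : (0 : ℝ) < Nat.card G := Nat.cast_pos.2 Nat.card_pos
  have hDm : (H.index : ℝ) ≤ Nat.card G := by
    have : (1 : ℝ) ≤ Nat.card H := by exact_mod_cast (Nat.card_pos : 0 < Nat.card H)
    nlinarith
  have he : 0 ≤ 1 - Real.exp (-(d ^ 2 / 8 * α) * (offCount H F / 2)) := by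
    rw [sub_nonneg, Real.exp_le_one_iff, neg_mul, neg_nonpos]
    positivity
  set u := 1 - Real.exp (-(d ^ 2 / 8 * α) * (offCount H F / 2)) with hu
  set w := Nat.card G * Real.exp (-(d ^ 2 / 8 * α) * t) with hw
  have hw0 : 0 ≤ w := by positivity
  rw [inv_mul_eq_div, le_div_iff₀ hH]
  have h1 : μ.real {ω | ∑ i, Y i ω • F i = v} * Nat.card H ≤ -(u / H.index) + w / H.index + 1 := by
    have : -(u / H.index) + w / H.index + 1 = (H.index - u + w) / H.index := by
      field_simp
      ring
    rw [this, le_div_iff₀ (by linarith), mul_assoc, hprod, mul_comm]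
    exact hmain
  refine h1.trans ((Real.add_one_le_exp _).trans (Real.exp_le_exp.2 (add_le_add ?_ ?_)))
  · rw [neg_le_neg_iff]
    gcongr
  · exact div_le_self hw0 hD

end ColumnBounds

/-! ### Counting vectors with few entries outside a subgroup -/

section Counting

variable {G : Type*} [AddCommGroup G] [Finite G]

omit [Finite G] in
lemma sum_pow_offCount [Fintype G] {ι : Type*} [Fintype ι] [DecidableEq ι] (H : AddSubgroup G)
    (r : ℝ) :
    ∑ F : ι → G, r ^ offCount H F =
      (Nat.card H + r * ((Nat.card G : ℝ) - Nat.card H)) ^ Fintype.card ι := by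
  classical
  have h1 : ∑ g : G, (if g ∉ H then r else 1) = Nat.card H + r * ((Nat.card G : ℝ) - Nat.card H) := by
    have hH : (Finset.univ.filter fun g => g ∈ H).card = Nat.card H := by
      rw [Nat.card_eq_fintype_card, Fintype.card_subtype]
    have hG : (Nat.card G : ℝ) = (Finset.univ.filter fun g => g ∈ H).card +
        (Finset.univ.filter fun g => g ∉ H).card := by
      rw [Nat.card_eq_fintype_card, ← Finset.card_univ]
      exact_mod_cast (Finset.card_filter_add_card_filter_not (fun g => g ∈ H)).symm
    rw [hG, ← hH, Finset.sum_ite]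
    simp only [Finset.sum_const, nsmul_eq_mul, not_not, mul_one]
    ring
  have h2 := Finset.prod_univ_sum (fun _ : ι => (Finset.univ : Finset G))
    fun _ g => if g ∉ H then r else 1
  rw [Finset.prod_const, h1, Finset.card_univ, Fintype.piFinset_univ] at h2
  rw [h2]
  refine Finset.sum_congr rfl fun F _ => ?_
  rw [Finset.prod_ite, Finset.prod_const_one, mul_one, Finset.prod_const, offCount]

lemma sum_pow_offCount_le [Fintype G] {ι : Type*} [Fintype ι] [DecidableEq ι] (H : AddSubgroup G)
    {r : ℝ} (hr : 0 ≤ r) :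
    ∑ F : ι → G, r ^ offCount H F ≤
      (Nat.card H : ℝ) ^ Fintype.card ι * Real.exp (Fintype.card ι * (r * Nat.card G)) := by
  have hH : (1 : ℝ) ≤ Nat.card H := by exact_mod_cast (Nat.card_pos : 0 < Nat.card H)
  have hHG : (Nat.card H : ℝ) ≤ Nat.card G := by
    exact_mod_cast Nat.le_of_dvd Nat.card_pos H.card_addSubgroup_dvd_card
  have hm : (0 : ℝ) ≤ Nat.card G := Nat.cast_nonneg _
  rw [sum_pow_offCount, Real.exp_nat_mul, ← mul_pow]
  have h1 : 0 ≤ r * ((Nat.card G : ℝ) - Nat.card H) := mul_nonneg hr (by linarith)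
  refine pow_le_pow_left₀ (by positivity) ?_ _
  calc (Nat.card H : ℝ) + r * ((Nat.card G : ℝ) - Nat.card H)
      ≤ Nat.card H * (r * Nat.card G + 1) := by
        have : r * Nat.card G ≤ Nat.card H * (r * Nat.card G) :=
          le_mul_of_one_le_left (by positivity) hH
        have : 0 ≤ r * Nat.card H := by positivity
        linarith
    _ ≤ _ := by
        gcongr
        exact Real.add_one_le_exp _

/-- A proportion of entries so small that, for a group `G` of order `m` and a subgroup `H`, vectors
of length `n` with at most `m * spreadRate m * n` entries outside `H` outnumber the vectors in `H` by
a factor of at most `exp (n / (4 * m))`, see `card_offCount_le`. -/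
noncomputable def spreadRate (m : ℕ) : ℝ := (8 * m ^ 2 * Real.log (8 * m ^ 2))⁻¹

lemma spreadRate_pos {m : ℕ} (hm : 0 < m) : 0 < spreadRate m := by
  have h1 : (1 : ℝ) ≤ m := by exact_mod_cast hm
  have : 0 < Real.log (8 * (m : ℝ) ^ 2) := Real.log_pos (by nlinarith)
  unfold spreadRate
  positivity

open Classical in
lemma card_offCount_le [Fintype G] (n : ℕ) (H : AddSubgroup G) :
    ((Finset.univ.filter fun F : Fin n → G =>
      (offCount H F : ℝ) ≤ Nat.card G * (spreadRate (Nat.card G) * n)).card : ℝ) ≤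
      (Nat.card H : ℝ) ^ n * Real.exp (n / (4 * Nat.card G)) := by
  set m := Nat.card G with hm
  have hm1 : (1 : ℝ) ≤ m := by exact_mod_cast (Nat.card_pos : 0 < Nat.card G)
  have hlog : 0 < Real.log (8 * (m : ℝ) ^ 2) := Real.log_pos (by nlinarith)
  set T := (m : ℝ) * (spreadRate m * n) with hT
  set L := Real.log (8 * (m : ℝ) ^ 2) with hL
  have hTL : T * L = n / (8 * m) := by
    rw [hT, spreadRate, ← hL]
    field_simp
  -- An exponential Markov inequality with the parameter `1 / (8 * m ^ 2)`.
  have h1 : ∀ F : Fin n → G, (if (offCount H F : ℝ) ≤ T then (1 : ℝ) else 0) ≤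
      Real.exp (n / (8 * m)) * (8 * (m : ℝ) ^ 2)⁻¹ ^ offCount H F := by
    intro F
    split_ifs with h
    · rw [← Real.exp_log (show 0 < (8 * (m : ℝ) ^ 2)⁻¹ by positivity), ← Real.exp_nat_mul,
        ← Real.exp_add, Real.log_inv, ← hL, ← hTL, Real.one_le_exp_iff]
      nlinarith
    · positivity
  rw [Finset.card_filter]
  push_cast
  refine (Finset.sum_le_sum fun F _ => h1 F).trans ?_
  rw [← Finset.mul_sum]
  refine (mul_le_mul_of_nonneg_left (sum_pow_offCount_le H (by positivity))
    (Real.exp_pos _).le).trans_eq ?_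
  rw [mul_left_comm, ← Real.exp_add, Fintype.card_fin, ← hm]
  congr 2
  field_simp
  ring

end Counting

/-! ### Columns of the random matrix -/

section Columns

variable {Ω : Type*} [MeasurableSpace Ω] {μ : Measure Ω} [IsProbabilityMeasure μ] {n : ℕ}
  {X : Ω → Matrix (Fin n) (Fin n) ℤ}

lemma iIndepFun_columns (hX : ∀ i j, Measurable fun ω => X ω i j)
    (hind : iIndepFun (fun (ij : Fin n × Fin n) ω => X ω ij.1 ij.2) μ) :
    iIndepFun (fun j ω i => X ω i j) μ := by
  have h1 : iIndepFun (fun (ji : Fin n × Fin n) ω => X ω ji.2 ji.1) μ :=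
    hind.precomp Prod.swap_injective
  have hprob : ∀ j i, IsProbabilityMeasure (μ.map fun ω => X ω i j) :=
    fun j i => Measure.isProbabilityMeasure_map (hX i j).aemeasurable
  rw [iIndepFun_iff_map_fun_eq_infinitePi_map (by fun_prop)] at h1 ⊢
  have h2 := Measure.infinitePi_map_curry (fun (j i : Fin n) => μ.map fun ω => X ω i j)
  rw [← h1, Measure.map_map (by fun_prop) (by fun_prop)] at h2
  refine h2.trans ?_
  congr 1
  funext j
  have h3 : iIndepFun (fun i ω => X ω i j) μ :=
    hind.precomp (g := fun i => (i, j)) fun a b h => (Prod.ext_iff.1 h).1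
  rw [iIndepFun_iff_map_fun_eq_infinitePi_map (by fun_prop)] at h3
  exact h3.symm

omit [IsProbabilityMeasure μ] in
lemma iIndepFun_column (hind : iIndepFun (fun (ij : Fin n × Fin n) ω => X ω ij.1 ij.2) μ)
    (j : Fin n) : iIndepFun (fun i ω => X ω i j) μ :=
  hind.precomp (g := fun i => (i, j)) fun _ _ h => (Prod.ext_iff.1 h).1

variable {G : Type*} [AddCommGroup G]

lemma prob_forall_column_eq_prod (hX : ∀ i j, Measurable fun ω => X ω i j)
    (hind : iIndepFun (fun (ij : Fin n × Fin n) ω => X ω ij.1 ij.2) μ) (F v : Fin n → G) :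
    μ.real {ω | ∀ j, ∑ i, X ω i j • F i = v j} =
      ∏ j, μ.real {ω | ∑ i, X ω i j • F i = v j} := by
  have h := (iIndepFun_columns hX hind).meas_iInter
    (s := fun j => {ω | ∑ i, X ω i j • F i = v j})
    fun j => ⟨{y : Fin n → ℤ | ∑ i, y i • F i = v j}, MeasurableSet.of_discrete, rfl⟩
  simp only [measureReal_def, ← ENNReal.toReal_prod, ← h, Set.ofPred_forall]

end Columns

/-! ### The expected number of solutions for fixed `n` -/

section FixedSize

variable {G : Type*} [AddCommGroup G] [Finite G]
  {Ω : Type*} [MeasurableSpace Ω] {μ : Measure Ω} [IsProbabilityMeasure μ] {n : ℕ}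
  {X : Ω → Matrix (Fin n) (Fin n) ℤ} {P : Finset ℕ} {α d t : ℝ} {F : Fin n → G}

lemma abs_prod_sub_one_le {ι : Type*} (s : Finset ι) (x : ι → ℝ) {ε : ℝ}
    (h : ∀ i ∈ s, |x i - 1| ≤ ε) : |∏ i ∈ s, x i - 1| ≤ Real.exp (s.card * ε) - 1 := by
  classical
  induction s using Finset.induction_on with
  | empty => simp
  | insert a s ha ih =>
    have hx := h a (Finset.mem_insert_self a s)
    have hs := ih fun i hi => h i (Finset.mem_insert_of_mem hi)
    have hxa : |x a| ≤ Real.exp ε := by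
      have h1 := abs_add_le (x a - 1) 1
      rw [sub_add_cancel, abs_one] at h1
      linarith [Real.add_one_le_exp ε]
    rw [Finset.prod_insert ha, Finset.card_insert_of_notMem ha]
    have h2 : x a * ∏ i ∈ s, x i - 1 = x a * (∏ i ∈ s, x i - 1) + (x a - 1) := by ring
    have h3 : Real.exp ((s.card + 1 : ℕ) * ε) = Real.exp ε * Real.exp (s.card * ε) := by
      rw [← Real.exp_add]
      push_cast
      ring_nf
    rw [h2, h3]
    calc |x a * (∏ i ∈ s, x i - 1) + (x a - 1)|
        ≤ |x a| * |∏ i ∈ s, x i - 1| + |x a - 1| := by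
          rw [← abs_mul]
          exact abs_add_le _ _
      _ ≤ Real.exp ε * (Real.exp (s.card * ε) - 1) + (Real.exp ε - 1) := by
          refine add_le_add (mul_le_mul hxa hs (abs_nonneg _) (Real.exp_pos _).le) ?_
          linarith [Real.add_one_le_exp ε]
      _ = _ := by ring

/-- A smooth form of `1 - exp (-u) ≥ min (1 / 2) (u / 2)`. -/
lemma exp_neg_one_sub_exp_le {u : ℝ} (hu : 0 ≤ u) {c : ℝ} (hc : 0 ≤ c) :
    Real.exp (-(c * (1 - Real.exp (-u)))) ≤ Real.exp (-(c / 2)) + Real.exp (-(c * (u / 2))) := by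
  rcases le_total u 1 with h | h
  · have h1 : u / 2 ≤ 1 - Real.exp (-u) := by
      have h2 : Real.exp (-u) * (1 + u) ≤ 1 := by
        rw [Real.exp_neg, inv_mul_le_one₀ (Real.exp_pos u), add_comm]
        exact Real.add_one_le_exp u
      nlinarith [Real.exp_pos (-u)]
    refine le_add_of_nonneg_of_le (Real.exp_pos _).le (Real.exp_le_exp.2 ?_)
    rw [neg_le_neg_iff]
    gcongr
  · have h1 : Real.exp (-u) ≤ 1 / 2 := by
      have h2 : Real.exp (-u) ≤ Real.exp (-1) := Real.exp_le_exp.2 (by linarith)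
      have h3 := Real.exp_neg_one_lt_half
      linarith
    refine le_add_of_le_of_nonneg (Real.exp_le_exp.2 ?_) (Real.exp_pos _).le
    rw [neg_le_neg_iff]
    nlinarith

/-- For a vector spread out in the whole group, the column sums are jointly nearly uniform. -/
lemma abs_prob_forall_column_sub_le (hP : ∀ p : ℕ, p.Prime → p ∣ Nat.card G → p ∈ P)
    (hX : ∀ i j, Measurable fun ω => X ω i j)
    (hind : iIndepFun (fun (ij : Fin n × Fin n) ω => X ω ij.1 ij.2) μ)
    (hbal : ∀ i j, IsBalancedMod μ P α fun ω => X ω i j)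
    (hd0 : 0 < d) (hd : ∀ (χ : AddChar G ℂ) (g : G), χ g ≠ 1 → d ≤ ‖1 - χ g‖)
    (hα : 0 ≤ α) (hF : IsSpread t ⊤ F) (v : Fin n → G) :
    |μ.real {ω | ∀ j, ∑ i, X ω i j • F i = v j} - ((Nat.card G : ℝ) ^ n)⁻¹| ≤
      ((Nat.card G : ℝ) ^ n)⁻¹ *
        (Real.exp (n * (Nat.card G * Real.exp (-(d ^ 2 / 8 * α) * t))) - 1) := by
  have hm : (0 : ℝ) < Nat.card G := Nat.cast_pos.2 Nat.card_pos
  have h1 := abs_prod_sub_one_le (Finset.univ : Finset (Fin n))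
    (fun j => Nat.card G * μ.real {ω | ∑ i, X ω i j • F i = v j})
    fun j _ => abs_card_mul_prob_sub_one_le hP (hX · j) (iIndepFun_column hind j) (hbal · j)
      hd0 hd hα hF (v j)
  rw [Finset.prod_mul_distrib, ← prob_forall_column_eq_prod hX hind, Finset.prod_const,
    Finset.card_univ, Fintype.card_fin] at h1
  have h2 : μ.real {ω | ∀ j, ∑ i, X ω i j • F i = v j} - ((Nat.card G : ℝ) ^ n)⁻¹ =
      ((Nat.card G : ℝ) ^ n)⁻¹ *
        ((Nat.card G : ℝ) ^ n * μ.real {ω | ∀ j, ∑ i, X ω i j • F i = v j} - 1) := by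
    field_simp
  rw [h2, abs_mul, abs_of_nonneg (by positivity)]
  gcongr

/-- For a vector spread out in `H`, the comparison of the probability with `(#H) ^ (-n)`. When
`n * α / log n` tends to infinity, the first exponential is bounded and each entry outside `H` gains
a factor that is `o(1 / n)`, until the gain saturates at `exp (-n / (2 * #G))`. -/
lemma prob_forall_column_le (hP : ∀ p : ℕ, p.Prime → p ∣ Nat.card G → p ∈ P)
    (hX : ∀ i j, Measurable fun ω => X ω i j)
    (hind : iIndepFun (fun (ij : Fin n × Fin n) ω => X ω ij.1 ij.2) μ)
    (hbal : ∀ i j, IsBalancedMod μ P α fun ω => X ω i j)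
    (hd0 : 0 < d) (hd : ∀ (χ : AddChar G ℂ) (g : G), χ g ≠ 1 → d ≤ ‖1 - χ g‖)
    (hα : 0 ≤ α) {H : AddSubgroup G} (hF : IsSpread t H F) (v : Fin n → G) :
    μ.real {ω | ∀ j, ∑ i, X ω i j • F i = v j} ≤
      ((Nat.card H : ℝ) ^ n)⁻¹ *
        (Real.exp (n * (Nat.card G * Real.exp (-(d ^ 2 / 8 * α) * t))) *
        (Real.exp (-(n / (2 * Nat.card G))) +
          Real.exp (-(n * (d ^ 2 / 8 * α) / (4 * Nat.card G))) ^ offCount H F)) := by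
  have hm : (0 : ℝ) < Nat.card G := Nat.cast_pos.2 Nat.card_pos
  have h1 := Finset.prod_le_prod (s := (Finset.univ : Finset (Fin n)))
    (fun j _ => measureReal_nonneg)
    fun j _ => prob_le_exp hP (hX · j) (iIndepFun_column hind j) (hbal · j) hd0 hd hα hF (v j)
  rw [← prob_forall_column_eq_prod hX hind, Finset.prod_const, Finset.card_univ, Fintype.card_fin,
    mul_pow, ← Real.exp_nat_mul, mul_add, Real.exp_add, inv_pow] at h1
  refine h1.trans ?_
  rw [mul_comm (Real.exp _) (Real.exp _)]
  gcongr
  have h2 := exp_neg_one_sub_exp_le (u := d ^ 2 / 8 * α * (offCount H F / 2)) (by positivity)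
    (c := n / Nat.card G) (by positivity)
  rw [← Real.exp_nat_mul]
  refine (le_of_eq ?_).trans (h2.trans_eq ?_)
  · rw [neg_mul]
    congr 1
    ring
  · congr 2 <;> ring

open Classical in
lemma card_not_isSpread_top_le [Fintype G] (n : ℕ) :
    ((Finset.univ.filter fun F : Fin n → G =>
      ¬ IsSpread (spreadRate (Nat.card G) * n) ⊤ F).card : ℝ) ≤
      Nat.card (AddSubgroup G) * ((Nat.card G : ℝ) ^ n * (Real.exp (1 / 4) / 2) ^ n) := by
  cases nonempty_fintype (AddSubgroup G)
  have hm1 : (1 : ℝ) ≤ Nat.card G := by exact_mod_cast (Nat.card_pos : 0 < Nat.card G)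
  have ht : 0 ≤ spreadRate (Nat.card G) * n :=
    mul_nonneg (spreadRate_pos Nat.card_pos).le n.cast_nonneg
  have hsub : (Finset.univ.filter fun F : Fin n → G =>
      ¬ IsSpread (spreadRate (Nat.card G) * n) ⊤ F) ⊆
      (Finset.univ.filter fun H : AddSubgroup G => H ≠ ⊤).biUnion fun H =>
        Finset.univ.filter fun F : Fin n → G =>
          (offCount H F : ℝ) ≤ Nat.card G * (spreadRate (Nat.card G) * n) := by
    intro F hF
    obtain ⟨H, hH, hoff⟩ := exists_isSpread ht F
    simp only [Finset.mem_biUnion, Finset.mem_filter, Finset.mem_univ, true_and] at hF ⊢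
    exact ⟨H, fun h => hF (h ▸ hH), hoff⟩
  refine (Nat.cast_le.2 ((Finset.card_le_card hsub).trans Finset.card_biUnion_le)).trans ?_
  push_cast
  refine (Finset.sum_le_card_nsmul _ _ ((Nat.card G : ℝ) ^ n * (Real.exp (1 / 4) / 2) ^ n)
    fun H hH => (card_offCount_le n H).trans ?_).trans ?_
  · have hne : H ≠ ⊤ := (Finset.mem_filter.1 hH).2
    have h2 : (Nat.card H : ℝ) * 2 ≤ Nat.card G := by
      have h3 : 1 < H.index :=
        Nat.one_lt_iff_ne_zero_and_ne_one.2
          ⟨AddSubgroup.index_ne_zero_of_finite, fun h => hne (AddSubgroup.index_eq_one.1 h)⟩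
      rw [← H.card_mul_index]
      exact_mod_cast Nat.mul_le_mul_left _ h3
    rw [← mul_pow, show (n : ℝ) / (4 * Nat.card G) = n * (1 / (4 * Nat.card G)) by ring,
      Real.exp_nat_mul, ← mul_pow]
    refine pow_le_pow_left₀ (by positivity) ?_ _
    rw [← mul_div_assoc, mul_div_right_comm]
    refine mul_le_mul (by linarith) (Real.exp_le_exp.2 ?_) (Real.exp_pos _).le (by positivity)
    gcongr
    linarith
  · rw [nsmul_eq_mul]
    gcongr
    rw [Nat.card_eq_fintype_card]
    exact Finset.card_le_univ _

open Classical in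
/-- A generating vector that is not spread out in `G` is spread out in a proper subgroup `H`, outside
of which it has at least one entry. Summing the bound of `prob_forall_column_le` over such vectors
for fixed `H` gives, for the saturated part, at most `exp (n / (4 * #G)) * exp (-n / (2 * #G))`
by `card_offCount_le`, and for the other part a generating function without its constant term. -/
lemma sum_prob_not_isSpread_top_le [Fintype G] (hP : ∀ p : ℕ, p.Prime → p ∣ Nat.card G → p ∈ P)
    (hX : ∀ i j, Measurable fun ω => X ω i j)
    (hind : iIndepFun (fun (ij : Fin n × Fin n) ω => X ω ij.1 ij.2) μ)
    (hbal : ∀ i j, IsBalancedMod μ P α fun ω => X ω i j)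
    (hd0 : 0 < d) (hd : ∀ (χ : AddChar G ℂ) (g : G), χ g ≠ 1 → d ≤ ‖1 - χ g‖)
    (hα : 0 ≤ α) (T : (Fin n → G) → Fin n → G) :
    ∑ F : Fin n → G with AddSubgroup.closure (Set.range F) = ⊤ ∧
        ¬ IsSpread (spreadRate (Nat.card G) * n) ⊤ F,
      μ.real {ω | ∀ j, ∑ i, X ω i j • F i = T F j} ≤
      Nat.card (AddSubgroup G) *
        (Real.exp (n * (Nat.card G * Real.exp (-(d ^ 2 / 8 * α) * (spreadRate (Nat.card G) * n)))) *
        (Real.exp (-(n / (4 * Nat.card G))) +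
          (Real.exp (n * (Real.exp (-(n * (d ^ 2 / 8 * α) / (4 * Nat.card G))) * Nat.card G))
            - 1))) := by
  cases nonempty_fintype (AddSubgroup G)
  have hm : (0 : ℝ) < Nat.card G := Nat.cast_pos.2 Nat.card_pos
  set t := spreadRate (Nat.card G) * n with ht_def
  have ht : 0 ≤ t := mul_nonneg (spreadRate_pos Nat.card_pos).le n.cast_nonneg
  set E := Real.exp (n * (Nat.card G * Real.exp (-(d ^ 2 / 8 * α) * t))) with hE
  set a := Real.exp (-(n * (d ^ 2 / 8 * α) / (4 * Nat.card G))) with ha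
  have ha0 : 0 ≤ a := (Real.exp_pos _).le
  have hE0 : 0 ≤ E := (Real.exp_pos _).le
  let S : AddSubgroup G → Finset (Fin n → G) := fun H => Finset.univ.filter fun F =>
    IsSpread t H F ∧ (offCount H F : ℝ) ≤ Nat.card G * t ∧ offCount H F ≠ 0
  have hsub : (Finset.univ.filter fun F : Fin n → G => AddSubgroup.closure (Set.range F) = ⊤ ∧
      ¬ IsSpread t ⊤ F) ⊆ Finset.univ.biUnion S := by
    intro F hF
    obtain ⟨H, hH, hoff⟩ := exists_isSpread ht F
    simp only [S, Finset.mem_biUnion, Finset.mem_filter, Finset.mem_univ, true_and] at hF ⊢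
    refine ⟨H, hH, hoff, fun h0 => hF.2 ?_⟩
    have htop : H = ⊤ := by
      rw [← top_le_iff, ← hF.1, AddSubgroup.closure_le]
      rintro _ ⟨i, rfl⟩
      by_contra hi
      exact Finset.notMem_empty i (Finset.card_eq_zero.1 h0 ▸ by simpa using hi)
    exact htop ▸ hH
  refine (Finset.sum_le_sum_of_subset_of_nonneg hsub fun _ _ _ => measureReal_nonneg).trans ?_
  have hbi : ∑ F ∈ Finset.univ.biUnion S, μ.real {ω | ∀ j, ∑ i, X ω i j • F i = T F j} ≤
      ∑ H : AddSubgroup G, ∑ F ∈ S H, μ.real {ω | ∀ j, ∑ i, X ω i j • F i = T F j} := by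
    have hsig := Finset.sum_sigma Finset.univ S
      fun x : (_ : AddSubgroup G) × (Fin n → G) =>
        μ.real {ω | ∀ j, ∑ i, X ω i j • x.2 i = T x.2 j}
    rw [← hsig, ← Finset.sum_fiberwise_of_maps_to (t := Finset.univ.biUnion S)
      (g := fun x => x.2) fun x hx => Finset.mem_biUnion.2
        ⟨x.1, Finset.mem_univ _, (Finset.mem_sigma.1 hx).2⟩]
    refine Finset.sum_le_sum fun F hF => ?_
    obtain ⟨H, -, hH⟩ := Finset.mem_biUnion.1 hF
    exact Finset.single_le_sum
      (f := fun x : (_ : AddSubgroup G) × (Fin n → G) =>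
        μ.real {ω | ∀ j, ∑ i, X ω i j • x.2 i = T x.2 j})
      (fun _ _ => measureReal_nonneg) (a := ⟨H, F⟩)
      (Finset.mem_filter.2 ⟨Finset.mem_sigma.2 ⟨Finset.mem_univ _, hH⟩, rfl⟩)
  refine hbi.trans ?_
  rw [Nat.card_eq_fintype_card, ← nsmul_eq_mul, ← Finset.card_univ]
  refine Finset.sum_le_card_nsmul _ _ _ fun H _ => ?_
  have hH0 : (0 : ℝ) < (Nat.card H : ℝ) ^ n := pow_pos (Nat.cast_pos.2 Nat.card_pos) n
  calc ∑ F ∈ S H, μ.real {ω | ∀ j, ∑ i, X ω i j • F i = T F j}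
      ≤ ∑ F ∈ S H, ((Nat.card H : ℝ) ^ n)⁻¹ *
        (E * (Real.exp (-(n / (2 * Nat.card G))) + a ^ offCount H F)) :=
        Finset.sum_le_sum fun F hF =>
          prob_forall_column_le hP hX hind hbal hd0 hd hα (Finset.mem_filter.1 hF).2.1 _
    _ = ((Nat.card H : ℝ) ^ n)⁻¹ * (E * ((S H).card * Real.exp (-(n / (2 * Nat.card G))) +
          ∑ F ∈ S H, a ^ offCount H F)) := by
        rw [← Finset.mul_sum, ← Finset.mul_sum, Finset.sum_add_distrib, Finset.sum_const,
          nsmul_eq_mul]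
    _ ≤ ((Nat.card H : ℝ) ^ n)⁻¹ * (E * ((Nat.card H : ℝ) ^ n * Real.exp (-(n / (4 * Nat.card G))) +
          (Nat.card H : ℝ) ^ n * (Real.exp (n * (a * Nat.card G)) - 1))) := by
        refine mul_le_mul_of_nonneg_left (mul_le_mul_of_nonneg_left (add_le_add ?_ ?_) hE0)
          (inv_nonneg.2 hH0.le)
        · have h1 : ((S H).card : ℝ) ≤ (Nat.card H : ℝ) ^ n * Real.exp (n / (4 * Nat.card G)) := by
            refine le_trans (Nat.cast_le.2 (Finset.card_le_card fun F hF => ?_))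
              (card_offCount_le n H)
            exact Finset.mem_filter.2 ⟨Finset.mem_univ _, (Finset.mem_filter.1 hF).2.2.1⟩
          refine (mul_le_mul_of_nonneg_right h1 (Real.exp_pos _).le).trans_eq ?_
          rw [mul_assoc, ← Real.exp_add]
          congr 2
          field_simp
          ring
        · -- The vectors with all entries in `H` account for the term subtracted.
          have h1 := sum_pow_offCount_le (ι := Fin n) H ha0
          rw [Fintype.card_fin] at h1
          have h2 : (Nat.card H : ℝ) ^ n = ∑ F : Fin n → G, (0 : ℝ) ^ offCount H F := by
            rw [sum_pow_offCount]
            simp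
          have h3 : ∑ F ∈ S H, a ^ offCount H F ≤
              ∑ F : Fin n → G, (a ^ offCount H F - 0 ^ offCount H F) := by
            have h4 : ∑ F ∈ S H, a ^ offCount H F =
                ∑ F ∈ S H, (a ^ offCount H F - 0 ^ offCount H F) :=
              Finset.sum_congr rfl fun F hF => by
                rw [zero_pow (Finset.mem_filter.1 hF).2.2.2, sub_zero]
            rw [h4]
            refine Finset.sum_le_sum_of_subset_of_nonneg (Finset.subset_univ _) fun F _ _ => ?_
            exact sub_nonneg.2 (pow_le_pow_left₀ le_rfl ha0 _)
          rw [Finset.sum_sub_distrib, ← h2] at h3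
          linarith
    _ = _ := by
        field_simp

open Classical in
/-- The total over `t`-spread vectors is `m ^ (-n)` times their number up to a small relative error,
and all other vectors, weighted or not, are negligible. -/
lemma abs_sum_prob_sub_le [Fintype G] (hP : ∀ p : ℕ, p.Prime → p ∣ Nat.card G → p ∈ P)
    (hX : ∀ i j, Measurable fun ω => X ω i j)
    (hind : iIndepFun (fun (ij : Fin n × Fin n) ω => X ω ij.1 ij.2) μ)
    (hbal : ∀ i j, IsBalancedMod μ P α fun ω => X ω i j)
    (hd0 : 0 < d) (hd : ∀ (χ : AddChar G ℂ) (g : G), χ g ≠ 1 → d ≤ ‖1 - χ g‖)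
    (hα : 0 ≤ α) (hn : 0 < n) (T : (Fin n → G) → Fin n → G) (A : Finset (Fin n → G)) :
    |∑ F ∈ A with AddSubgroup.closure (Set.range F) = ⊤,
        μ.real {ω | ∀ j, ∑ i, X ω i j • F i = T F j} - A.card / (Nat.card G : ℝ) ^ n| ≤
      (Real.exp (n * (Nat.card G * Real.exp (-(d ^ 2 / 8 * α) * (spreadRate (Nat.card G) * n))))
        - 1) +
      Nat.card (AddSubgroup G) * (Real.exp (1 / 4) / 2) ^ n +
      Nat.card (AddSubgroup G) *
        (Real.exp (n * (Nat.card G * Real.exp (-(d ^ 2 / 8 * α) * (spreadRate (Nat.card G) * n)))) *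
        (Real.exp (-(n / (4 * Nat.card G))) +
          (Real.exp (n * (Real.exp (-(n * (d ^ 2 / 8 * α) / (4 * Nat.card G))) * Nat.card G))
            - 1))) := by
  have hm : (0 : ℝ) < Nat.card G := Nat.cast_pos.2 Nat.card_pos
  have h3 := sum_prob_not_isSpread_top_le hP hX hind hbal hd0 hd hα T
  have h2 := card_not_isSpread_top_le (G := G) n
  set t := spreadRate (Nat.card G) * n with ht_def
  have ht : 0 < t := mul_pos (spreadRate_pos Nat.card_pos) (Nat.cast_pos.2 hn)
  set q : (Fin n → G) → ℝ := fun F => μ.real {ω | ∀ j, ∑ i, X ω i j • F i = T F j} with hq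
  set E := Real.exp (n * (Nat.card G * Real.exp (-(d ^ 2 / 8 * α) * t))) with hE
  have hE1 : 0 ≤ E - 1 := by
    rw [sub_nonneg, hE, Real.one_le_exp_iff]
    positivity
  have hgen : ∀ F : Fin n → G, IsSpread t ⊤ F → AddSubgroup.closure (Set.range F) = ⊤ := by
    intro F hF
    by_contra hne
    have h := hF _ (lt_top_iff_ne_top.2 hne)
    rw [Finset.filter_false_of_mem fun i _ hi =>
      hi.2 (AddSubgroup.subset_closure ⟨i, rfl⟩)] at h
    simp at h
    linarith
  have hsplit : ∑ F ∈ A with AddSubgroup.closure (Set.range F) = ⊤, q F =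
      ∑ F ∈ A with IsSpread t ⊤ F, q F +
        ∑ F ∈ A with AddSubgroup.closure (Set.range F) = ⊤ ∧ ¬ IsSpread t ⊤ F, q F := by
    rw [← Finset.sum_filter_add_sum_filter_not _ (fun F => IsSpread t ⊤ F), Finset.filter_filter,
      Finset.filter_filter]
    congr 2
    ext F
    simp only [Finset.mem_filter, and_congr_right_iff, and_iff_right_iff_imp]
    exact fun _ => hgen F
  have hcard : (A.card : ℝ) = (A.filter fun F => IsSpread t ⊤ F).card +
      (A.filter fun F => ¬ IsSpread t ⊤ F).card := by
    exact_mod_cast (Finset.card_filter_add_card_filter_not (fun F => IsSpread t ⊤ F)).symm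
  have hAcard : (A.card : ℝ) ≤ (Nat.card G : ℝ) ^ n := by
    have := Finset.card_le_univ A
    rw [Fintype.card_fun, Fintype.card_fin, ← Nat.card_eq_fintype_card] at this
    exact_mod_cast this
  have hspread : |∑ F ∈ A with IsSpread t ⊤ F, q F -
      (A.filter fun F => IsSpread t ⊤ F).card / (Nat.card G : ℝ) ^ n| ≤ E - 1 := by
    have h4 : ∑ F ∈ A with IsSpread t ⊤ F, q F -
        (A.filter fun F => IsSpread t ⊤ F).card / (Nat.card G : ℝ) ^ n =
        ∑ F ∈ A with IsSpread t ⊤ F, (q F - ((Nat.card G : ℝ) ^ n)⁻¹) := by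
      rw [Finset.sum_sub_distrib, Finset.sum_const, nsmul_eq_mul, div_eq_mul_inv]
    rw [h4]
    refine (Finset.abs_sum_le_sum_abs _ _).trans ((Finset.sum_le_card_nsmul _ _
      (((Nat.card G : ℝ) ^ n)⁻¹ * (E - 1)) fun F hF =>
        abs_prob_forall_column_sub_le hP hX hind hbal hd0 hd hα (Finset.mem_filter.1 hF).2 _).trans
        ?_)
    rw [nsmul_eq_mul, ← mul_assoc]
    refine mul_le_of_le_one_left hE1 ?_
    rw [← div_eq_mul_inv, div_le_one (by positivity)]
    exact le_trans (Nat.cast_le.2 (Finset.card_filter_le _ _)) hAcard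
  have hrest : ((A.filter fun F => ¬ IsSpread t ⊤ F).card : ℝ) / (Nat.card G : ℝ) ^ n ≤
      Nat.card (AddSubgroup G) * (Real.exp (1 / 4) / 2) ^ n := by
    rw [div_le_iff₀ (by positivity), mul_assoc, mul_comm (_ ^ n) ((Nat.card G : ℝ) ^ n)]
    exact le_trans (Nat.cast_le.2 (Finset.card_le_card
      (Finset.filter_subset_filter _ (Finset.subset_univ A)))) h2
  have hnot : ∑ F ∈ A with AddSubgroup.closure (Set.range F) = ⊤ ∧ ¬ IsSpread t ⊤ F, q F ≤ _ :=
    (Finset.sum_le_sum_of_subset_of_nonneg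
      (Finset.filter_subset_filter _ (Finset.subset_univ A)) fun _ _ _ => measureReal_nonneg).trans
      h3
  have hnot0 : 0 ≤ ∑ F ∈ A with AddSubgroup.closure (Set.range F) = ⊤ ∧ ¬ IsSpread t ⊤ F, q F :=
    Finset.sum_nonneg fun _ _ => measureReal_nonneg
  have hrest0 : 0 ≤ ((A.filter fun F => ¬ IsSpread t ⊤ F).card : ℝ) / (Nat.card G : ℝ) ^ n := by
    positivity
  rw [hsplit, hcard, add_div, abs_le]
  rw [abs_le] at hspread
  constructor <;> linarith [hspread.1, hspread.2]

end FixedSize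

/-! ### Vectors annihilated by `B` -/

section Kernel

variable {G : Type*} [AddCommGroup G] {n k : ℕ}

/-- The action of the transpose of an integer matrix on vectors with entries in `G`. -/
def transposeAct (G : Type*) [AddCommGroup G] (B : Matrix (Fin n) (Fin k) ℤ) :
    (Fin n → G) →+ (Fin k → G) where
  toFun F r := ∑ i, B i r • F i
  map_zero' := by
    ext
    simp
  map_add' F F' := by
    ext
    simp [Finset.sum_add_distrib]

lemma transposeAct_apply (B : Matrix (Fin n) (Fin k) ℤ) (F : Fin n → G) (r : Fin k) :
    transposeAct G B F r = ∑ i, B i r • F i := rfl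

/-- A right inverse of the transpose of `B` modulo `p`, lifted to `ℤ`, provides `F`. -/
lemma exists_eq_transposeAct_add_prime_nsmul {B : Matrix (Fin n) (Fin k) ℤ} {p : ℕ}
    (hp : p.Prime) (hB : (B.map (Int.cast : ℤ → ZMod p)).rank = k) (w : Fin k → G) :
    ∃ F z, w = transposeAct G B F + p • z := by
  have := Fact.mk hp
  have hsurj : Function.Surjective ((B.map (Int.cast : ℤ → ZMod p)).transpose).mulVec := by
    have h1 : LinearMap.range (B.map (Int.cast : ℤ → ZMod p)).transpose.mulVecLin = ⊤ := by
      apply Submodule.eq_top_of_finrank_eq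
      rw [← Matrix.rank, Matrix.rank_transpose, hB]
      simp
    exact LinearMap.range_eq_top.1 h1
  obtain ⟨A', hA'⟩ := Matrix.mulVec_surjective_iff_exists_right_inverse.1 hsurj
  choose A hA using fun i s => ZMod.intCast_surjective (A' i s)
  have hdvd : ∀ r s, ∃ c : ℤ, ∑ i, B i r * A i s = (if r = s then 1 else 0) + p * c := by
    intro r s
    have h1 : ((∑ i, B i r * A i s - (if r = s then 1 else 0) : ℤ) : ZMod p) = 0 := by
      have h2 := congrFun (congrFun hA' r) s
      rw [Matrix.mul_apply, Matrix.one_apply] at h2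
      push_cast
      rw [sub_eq_zero, ← h2]
      exact Finset.sum_congr rfl fun i _ => by rw [hA]; rfl
    obtain ⟨c, hc⟩ := (ZMod.intCast_zmod_eq_zero_iff_dvd _ p).1 h1
    exact ⟨c, by rw [← hc]; ring⟩
  choose c hc using hdvd
  refine ⟨fun i => ∑ s, A i s • w s, fun r => -∑ s, c r s • w s, ?_⟩
  ext r
  have h3 : transposeAct G B (fun i => ∑ s, A i s • w s) r = w r + p • ∑ s, c r s • w s := by
    have h4 : transposeAct G B (fun i => ∑ s, A i s • w s) r =
        ∑ s, (∑ i, B i r * A i s) • w s := by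
      simp only [transposeAct_apply, Finset.smul_sum, smul_smul, Finset.sum_smul]
      exact Finset.sum_comm
    rw [h4, Finset.smul_sum]
    simp only [hc, add_smul, Finset.sum_add_distrib, ite_smul, one_smul,
      zero_smul, Finset.sum_ite_eq, Finset.mem_univ, if_true, mul_smul, natCast_zsmul]
  rw [Pi.add_apply, h3, Pi.smul_apply, smul_neg, add_neg_cancel_right]

/-- The range of `transposeAct` and the multiples of `d` generate everything, by induction on the
factorization of `d`; taking `d = #G` gives surjectivity. -/
lemma exists_eq_transposeAct_add_nsmul {B : Matrix (Fin n) (Fin k) ℤ} {P : Finset ℕ}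
    (hB : ∀ p ∈ P, p.Prime → (B.map (Int.cast : ℤ → ZMod p)).rank = k) (d : ℕ) (hd : d ≠ 0)
    (hdP : ∀ p : ℕ, p.Prime → p ∣ d → p ∈ P) (w : Fin k → G) :
    ∃ F z, w = transposeAct G B F + d • z := by
  induction d using induction_on_primes generalizing w with
  | zero => exact absurd rfl hd
  | one => exact ⟨0, w, by simp⟩
  | prime_mul p a hp ih =>
    obtain ⟨F, z, hz⟩ := exists_eq_transposeAct_add_prime_nsmul hp
      (hB p (hdP p hp (dvd_mul_right _ _)) hp) w
    obtain ⟨F', z', hz'⟩ := ih (right_ne_zero_of_mul hd)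
      (fun q hq hqa => hdP q hq (hqa.mul_left p)) z
    refine ⟨F + p • F', z', ?_⟩
    rw [hz, hz', map_add, map_nsmul, mul_smul, smul_add, add_assoc]

lemma transposeAct_surjective [Finite G] {B : Matrix (Fin n) (Fin k) ℤ} {P : Finset ℕ}
    (hB : ∀ p ∈ P, p.Prime → (B.map (Int.cast : ℤ → ZMod p)).rank = k)
    (hP : ∀ p : ℕ, p.Prime → p ∣ Nat.card G → p ∈ P) :
    Function.Surjective (transposeAct G B) := by
  intro w
  obtain ⟨F, z, hz⟩ := exists_eq_transposeAct_add_nsmul hB (Nat.card G) Nat.card_pos.ne' hP w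
  refine ⟨F, ?_⟩
  have : Nat.card G • z = 0 := by
    ext r
    exact card_nsmul_eq_zero'
  rw [hz, this, add_zero]

open Classical in
lemma card_ker_transposeAct_div [Fintype G] {B : Matrix (Fin n) (Fin k) ℤ}
    (h : Function.Surjective (transposeAct G B)) :
    ((Finset.univ.filter fun F : Fin n → G => transposeAct G B F = 0).card : ℝ) /
      (Nat.card G : ℝ) ^ n = ((Nat.card G : ℝ) ^ k)⁻¹ := by
  have h1 := (transposeAct G B).ker.card_mul_index
  rw [AddSubgroup.index_ker, AddMonoidHom.range_eq_top.2 h, AddSubgroup.card_top,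
    Nat.card_fun, Nat.card_fun, Nat.card_fin, Nat.card_fin] at h1
  have h2 : Nat.card (transposeAct G B).ker =
      (Finset.univ.filter fun F : Fin n → G => transposeAct G B F = 0).card := by
    rw [Nat.card_eq_fintype_card, Fintype.card_subtype]
    simp only [AddMonoidHom.mem_ker]
  rw [h2] at h1
  have hm : (0 : ℝ) < Nat.card G := Nat.cast_pos.2 Nat.card_pos
  rw [div_eq_iff (by positivity), inv_mul_eq_div, eq_div_iff (by positivity)]
  exact_mod_cast h1

end Kernel

/-! ### Surjections from the cokernel as vectors -/

section Cokernel

variable {n k : ℕ} {N : Type*} [AddCommGroup N] [Module ℤ[X] N]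

/-- The images of the standard basis vectors of `ℤ ^ n` under a morphism from the cokernel. -/
noncomputable def cokerVec (X : Matrix (Fin n) (Fin n) ℤ) (B : Matrix (Fin n) (Fin k) ℤ)
    (φ : WalkCoker X B →ₗ[ℤ[X]] N) (i : Fin n) : N :=
  φ (Submodule.mkQ _ (Module.AEval'.of X.mulVecLin (Pi.single i 1)))

variable {X : Matrix (Fin n) (Fin n) ℤ} {B : Matrix (Fin n) (Fin k) ℤ}

lemma apply_mkQ_of_eq_sum (φ : WalkCoker X B →ₗ[ℤ[X]] N) (v : Fin n → ℤ) :
    φ (Submodule.mkQ _ (Module.AEval'.of X.mulVecLin v)) = ∑ i, v i • cokerVec X B φ i := by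
  let f : (Fin n → ℤ) →ₗ[ℤ] N := (φ.toAddMonoidHom.comp ((Submodule.mkQ _).toAddMonoidHom.comp
    (Module.AEval'.of X.mulVecLin).toLinearMap.toAddMonoidHom)).toIntLinearMap
  change f v = ∑ i, v i • f (Pi.single i 1)
  simp_rw [← map_smul, ← map_sum]
  congr 1
  exact pi_eq_sum_univ' v

lemma cokerVec_injective : Function.Injective (cokerVec (N := N) X B) := by
  intro φ ψ h
  refine LinearMap.ext fun x => ?_
  obtain ⟨y, rfl⟩ := Submodule.mkQ_surjective _ x
  obtain ⟨v, rfl⟩ := (Module.AEval'.of X.mulVecLin).surjective y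
  rw [apply_mkQ_of_eq_sum, apply_mkQ_of_eq_sum, h]

/-- A vector annihilated by `B` and intertwining `X` with the variable of `ℤ[X]` defines a
morphism from the cokernel. -/
lemma exists_cokerVec_eq {F : Fin n → N} (hB : transposeAct N B F = 0)
    (hX : ∀ j, ∑ i, X i j • F i = (Polynomial.X : ℤ[X]) • F j) :
    ∃ φ, cokerVec X B φ = F := by
  let f : (Fin n → ℤ) →ₗ[ℤ] N := Fintype.linearCombination ℤ F
  have hf : ∀ v, f v = ∑ i, v i • F i := fun v => Fintype.linearCombination_apply ℤ F v
  have hfX : ∀ v, f (X.mulVec v) = (Polynomial.X : ℤ[X]) • f v := by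
    intro v
    rw [hf, hf, Finset.smul_sum]
    simp only [Matrix.mulVec, dotProduct, Finset.sum_smul]
    rw [Finset.sum_comm]
    refine Finset.sum_congr rfl fun j _ => ?_
    rw [smul_comm, ← hX, Finset.smul_sum]
    exact Finset.sum_congr rfl fun i _ => by rw [smul_smul, mul_comm]
  have hfB : ∀ (j : ℕ) (r : Fin k), f ((X ^ j * B).col r) = 0 := by
    intro j r
    induction j with
    | zero =>
      rw [pow_zero, Matrix.one_mul, hf]
      exact congrFun hB r
    | succ j ih =>
      have h1 : (X ^ (j + 1) * B).col r = X.mulVec ((X ^ j * B).col r) := by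
        rw [pow_succ', Matrix.mul_assoc]
        ext i
        simp [Matrix.mul_apply (M := X), Matrix.mulVec, dotProduct]
      rw [h1, hfX, ih, smul_zero]
  have hker : ∀ v ∈ walkRange X B, f v = 0 := by
    rintro _ ⟨c, rfl⟩
    have h1 : (walkMatrix X B).mulVecLin c =
        ∑ jr : Fin n × Fin k, c jr • (X ^ (jr.1 : ℕ) * B).col jr.2 := by
      ext a
      simp [walkMatrix, Matrix.mulVec, dotProduct, mul_comm]
    rw [h1, map_sum]
    exact Finset.sum_eq_zero fun jr _ => by rw [map_smul, hfB, smul_zero]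
  let φ₀ : Module.AEval' X.mulVecLin →ₗ[ℤ[X]] N := LinearMap.ofAEval X.mulVecLin f hfX
  refine ⟨Submodule.liftQ _ φ₀ fun y hy => ?_, ?_⟩
  · exact hker _ ((Module.AEval.mem_mapSubmodule_apply ℤ (Fin n → ℤ) X.mulVecLin).1 hy)
  · funext i
    change f (Pi.single i 1) = F i
    rw [hf, Finset.sum_eq_single i]
    · simp
    · intro b _ hb
      simp [Pi.single_eq_of_ne hb]
    · simp

lemma cokerVec_surjective_iff (φ : WalkCoker X B →ₗ[ℤ[X]] N) :
    Function.Surjective φ ↔ AddSubgroup.closure (Set.range (cokerVec X B φ)) = ⊤ := by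
  constructor
  · intro h
    rw [eq_top_iff]
    intro x _
    obtain ⟨y, rfl⟩ := h x
    obtain ⟨y, rfl⟩ := Submodule.mkQ_surjective _ y
    obtain ⟨v, rfl⟩ := (Module.AEval'.of X.mulVecLin).surjective y
    rw [apply_mkQ_of_eq_sum]
    exact sum_mem fun i _ => zsmul_mem (AddSubgroup.subset_closure (Set.mem_range_self i)) _
  · intro h
    have h1 : AddSubgroup.closure (Set.range (cokerVec X B φ)) ≤ φ.toAddMonoidHom.range := by
      rw [AddSubgroup.closure_le]
      rintro _ ⟨i, rfl⟩
      exact ⟨Submodule.mkQ _ (Module.AEval'.of X.mulVecLin (Pi.single i 1)), rfl⟩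
    rw [h, top_le_iff] at h1
    exact AddMonoidHom.range_eq_top.1 h1

lemma encard_moduleSur_walkCoker (X : Matrix (Fin n) (Fin n) ℤ) (B : Matrix (Fin n) (Fin k) ℤ)
    (N : Type*) [AddCommGroup N] [Module ℤ[X] N] :
    (moduleSur ℤ[X] (WalkCoker X B) N).encard =
      {F : Fin n → N | (transposeAct N B F = 0 ∧ AddSubgroup.closure (Set.range F) = ⊤) ∧
        ∀ j, ∑ i, X i j • F i = (Polynomial.X : ℤ[X]) • F j}.encard := by
  rw [← cokerVec_injective.encard_image]
  congr 1
  ext F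
  constructor
  · rintro ⟨φ, hφ, rfl⟩
    refine ⟨⟨?_, (cokerVec_surjective_iff φ).1 hφ⟩, fun j => ?_⟩
    · ext r
      have h1 := pow_mul_col_mem_walkRange X B 0 r
      rw [pow_zero, Matrix.one_mul] at h1
      have h2 : Submodule.mkQ (Module.AEval.mapSubmodule ℤ (Fin n → ℤ) X.mulVecLin
          ⟨walkRange X B, walkRange_mem_invtSubmodule X B⟩)
          (Module.AEval'.of X.mulVecLin (B.col r)) = 0 := by
        rw [Submodule.mkQ_apply, Submodule.Quotient.mk_eq_zero,
          Module.AEval.mem_mapSubmodule_apply]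
        exact h1
      have h3 := apply_mkQ_of_eq_sum φ (B.col r)
      rw [h2, map_zero] at h3
      exact h3.symm
    · have h1 := apply_mkQ_of_eq_sum φ (X.mulVecLin (Pi.single j 1))
      rw [← Module.AEval'.X_smul_of, map_smul, map_smul] at h1
      refine Eq.trans ?_ h1.symm
      simp [Matrix.col]
  · rintro ⟨⟨hB, hgen⟩, hX⟩
    obtain ⟨φ, rfl⟩ := exists_cokerVec_eq hB hX
    exact ⟨φ, (cokerVec_surjective_iff φ).2 hgen, rfl⟩

variable {Ω : Type*} [MeasurableSpace Ω] {μ : Measure Ω} [IsProbabilityMeasure μ]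

open Classical in
/-- By linearity of expectation, the vectors being fixed and the intertwining relation random. -/
lemma lintegral_encard_moduleSur [Fintype N] {X : Ω → Matrix (Fin n) (Fin n) ℤ}
    (hX : ∀ i j, Measurable fun ω => X ω i j) (B : Matrix (Fin n) (Fin k) ℤ) :
    ∫⁻ ω, ((moduleSur ℤ[X] (WalkCoker (X ω) B) N).encard : ℝ≥0∞) ∂μ =
      ENNReal.ofReal (∑ F ∈ Finset.univ.filter (fun F : Fin n → N => transposeAct N B F = 0) with
        AddSubgroup.closure (Set.range F) = ⊤,
        μ.real {ω | ∀ j, ∑ i, X ω i j • F i = (Polynomial.X : ℤ[X]) • F j}) := by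
  have hXm : Measurable fun ω => (fun i j => X ω i j : Fin n → Fin n → ℤ) :=
    measurable_pi_iff.2 fun i => measurable_pi_iff.2 fun j => hX i j
  have hmeas : ∀ F : Fin n → N,
      MeasurableSet {ω | ∀ j, ∑ i, X ω i j • F i = (Polynomial.X : ℤ[X]) • F j} := fun F =>
    hXm (MeasurableSet.of_discrete
      (s := {x : Fin n → Fin n → ℤ | ∀ j, ∑ i, x i j • F i = (Polynomial.X : ℤ[X]) • F j}))
  have hpt : ∀ ω, ((moduleSur ℤ[X] (WalkCoker (X ω) B) N).encard : ℝ≥0∞) =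
      ∑ F ∈ Finset.univ.filter (fun F : Fin n → N => transposeAct N B F = 0) with
        AddSubgroup.closure (Set.range F) = ⊤,
        {ω | ∀ j, ∑ i, X ω i j • F i = (Polynomial.X : ℤ[X]) • F j}.indicator
          (fun _ => (1 : ℝ≥0∞)) ω := by
    intro ω
    rw [encard_moduleSur_walkCoker]
    have h1 : {F : Fin n → N | (transposeAct N B F = 0 ∧ AddSubgroup.closure (Set.range F) = ⊤) ∧
        ∀ j, ∑ i, X ω i j • F i = (Polynomial.X : ℤ[X]) • F j} =
        ((((Finset.univ.filter fun F : Fin n → N => transposeAct N B F = 0).filter fun F =>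
          AddSubgroup.closure (Set.range F) = ⊤).filter fun F =>
          ∀ j, ∑ i, X ω i j • F i = (Polynomial.X : ℤ[X]) • F j : Finset (Fin n → N)) :
            Set (Fin n → N)) := by
      ext F
      simp
    rw [h1, Set.encard_coe_eq_coe_finsetCard, Finset.card_filter]
    simp [Set.indicator_apply]
  simp_rw [hpt]
  rw [lintegral_finsetSum _ fun F _ => measurable_const.indicator (hmeas F),
    ENNReal.ofReal_sum_of_nonneg fun F _ => measureReal_nonneg]
  refine Finset.sum_congr rfl fun F _ => ?_
  rw [lintegral_indicator_const (hmeas F), one_mul, ofReal_measureReal]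

end Cokernel

/-! ### The limit -/

/-- A density of order above `log n / n` makes exponential gains beat any fixed power of `n`. -/
lemma tendsto_nat_mul_exp_neg {α : ℕ → ℝ}
    (hα : Tendsto (fun n : ℕ => (n : ℝ) * α n / Real.log n) atTop atTop) {c : ℝ} (hc : 0 < c) :
    Tendsto (fun n : ℕ => (n : ℝ) * Real.exp (-(c * (n * α n)))) atTop (𝓝 0) := by
  refine squeeze_zero' (Eventually.of_forall fun n => by positivity) ?_
    tendsto_inv_atTop_nhds_zero_nat
  filter_upwards [hα.eventually_ge_atTop (2 / c), eventually_gt_atTop 1] with n h hn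
  have hn1 : (1 : ℝ) < n := by exact_mod_cast hn
  have hlog : 0 < Real.log n := Real.log_pos hn1
  have h1 : 2 * Real.log n ≤ c * (n * α n) := by
    rw [le_div_iff₀ hlog, div_mul_eq_mul_div, div_le_iff₀ hc] at h
    linarith
  calc (n : ℝ) * Real.exp (-(c * (n * α n))) ≤ n * Real.exp (-(2 * Real.log n)) := by gcongr
    _ = (n : ℝ)⁻¹ := by
      rw [two_mul, neg_add, Real.exp_add, Real.exp_neg, Real.exp_log (by linarith)]
      field_simp

theorem proposition3p1
    (P : Finset ℕ) (hP : ∀ p ∈ P, p.Prime)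
    (α : ℕ → ℝ)
    {Ω : ℕ → Type*} [∀ n, MeasurableSpace (Ω n)]
    (μ : ∀ n, Measure (Ω n)) [∀ n, IsProbabilityMeasure (μ n)]
    (X : ∀ n, Ω n → Matrix (Fin n) (Fin n) ℤ)
    (hX_meas : ∀ n, ∀ i j, Measurable fun ω => X n ω i j)
    (hX_indep : ∀ n, iIndepFun (fun (ij : Fin n × Fin n) ω => X n ω ij.1 ij.2) (μ n))
    (hX_bal : ∀ n, ∀ i j, IsBalancedMod (μ n) P (α n) fun ω => X n ω i j)
    (k : ℕ) (hk : 1 ≤ k)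
    (B : ∀ n, Matrix (Fin n) (Fin k) ℤ)
    (hB : ∀ n, k ≤ n → ∀ p ∈ P, ((B n).map (Int.cast : ℤ → ZMod p)).rank = k)
    (hα : Tendsto (fun n : ℕ => (n : ℝ) * α n / Real.log n) atTop atTop)
    (N : Type*) [AddCommGroup N] [Module ℤ[X] N] [Finite N]
    (hN : ∀ p : ℕ, p.Prime → p ∣ Nat.card N → p ∈ P) :
    Tendsto
      (fun n => ∫⁻ ω, ((moduleSur ℤ[X] (WalkCoker (X n ω) (B n)) N).encard : ℝ≥0∞) ∂(μ n))
      atTop (𝓝 (((Nat.card N : ℝ≥0∞) ^ k)⁻¹)) := by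
  classical
  cases nonempty_fintype N
  have hm : (0 : ℝ) < Nat.card N := Nat.cast_pos.2 Nat.card_pos
  have hδ : 0 < spreadRate (Nat.card N) := spreadRate_pos Nat.card_pos
  obtain ⟨d, hd0, hd⟩ := exists_char_gap N
  have hlim : (((Nat.card N : ℝ≥0∞) ^ k)⁻¹) = ENNReal.ofReal (((Nat.card N : ℝ) ^ k)⁻¹) := by
    rw [ENNReal.ofReal_inv_of_pos (by positivity), ENNReal.ofReal_pow hm.le,
      ENNReal.ofReal_natCast]
  simp_rw [lintegral_encard_moduleSur (hX_meas _)]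
  rw [hlim]
  refine ENNReal.tendsto_ofReal ?_
  have hx : Tendsto (fun n : ℕ => (n : ℝ) * (Nat.card N *
      Real.exp (-(d ^ 2 / 8 * α n) * (spreadRate (Nat.card N) * n)))) atTop (𝓝 0) := by
    have h := (tendsto_nat_mul_exp_neg hα
      (by positivity : 0 < d ^ 2 / 8 * spreadRate (Nat.card N))).const_mul (Nat.card N : ℝ)
    rw [mul_zero] at h
    refine h.congr fun n => ?_
    rw [mul_left_comm]
    congr 3
    ring
  have hy : Tendsto (fun n : ℕ => (n : ℝ) * (Real.exp (-(n * (d ^ 2 / 8 * α n) /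
      (4 * Nat.card N))) * Nat.card N)) atTop (𝓝 0) := by
    have h := (tendsto_nat_mul_exp_neg hα
      (by positivity : 0 < d ^ 2 / 8 / (4 * Nat.card N))).mul_const (Nat.card N : ℝ)
    rw [zero_mul] at h
    refine h.congr fun n => ?_
    rw [mul_assoc]
    congr 4
    ring
  have hz : Tendsto (fun n : ℕ => Real.exp (-((n : ℝ) / (4 * Nat.card N)))) atTop (𝓝 0) :=
    Real.tendsto_exp_neg_atTop_nhds_zero.comp
      (tendsto_natCast_atTop_atTop.atTop_div_const (by positivity))
  have hgeom : Tendsto (fun n : ℕ => (Real.exp (1 / 4) / 2) ^ n) atTop (𝓝 0) := by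
    refine tendsto_pow_atTop_nhds_zero_of_lt_one (by positivity) ?_
    rw [div_lt_one two_pos]
    have h1 := Real.exp_bound_div_one_sub_of_interval (x := 1 / 4) (by norm_num) (by norm_num)
    linarith
  have hxe : Tendsto (fun n : ℕ => Real.exp ((n : ℝ) * (Nat.card N *
      Real.exp (-(d ^ 2 / 8 * α n) * (spreadRate (Nat.card N) * n))))) atTop (𝓝 1) := by
    simpa using hx.rexp
  have hye : Tendsto (fun n : ℕ => Real.exp ((n : ℝ) * (Real.exp (-(n * (d ^ 2 / 8 * α n) /
      (4 * Nat.card N))) * Nat.card N))) atTop (𝓝 1) := by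
    simpa using hy.rexp
  have herr := ((hxe.sub_const 1).add (hgeom.const_mul (Nat.card (AddSubgroup N) : ℝ))).add
    ((hxe.mul (hz.add (hye.sub_const 1))).const_mul (Nat.card (AddSubgroup N) : ℝ))
  simp only [sub_self, mul_zero, add_zero] at herr
  rw [tendsto_iff_dist_tendsto_zero]
  refine squeeze_zero' (Eventually.of_forall fun n => dist_nonneg) ?_ herr
  filter_upwards [hα.eventually_ge_atTop 0, eventually_gt_atTop 1, eventually_ge_atTop k]
    with n hn0 hn1 hnk
  have hn1' : (1 : ℝ) < n := by exact_mod_cast hn1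
  have hαn : 0 ≤ α n := by
    have h1 : 0 ≤ (n : ℝ) * α n := by
      rw [le_div_iff₀ (Real.log_pos hn1'), zero_mul] at hn0
      exact hn0
    exact nonneg_of_mul_nonneg_right h1 (by linarith)
  have hsurj := transposeAct_surjective (fun p hp _ => hB n hnk p hp) hN
  rw [Real.dist_eq, ← card_ker_transposeAct_div hsurj]
  exact abs_sum_prob_sub_le hN (hX_meas n) (hX_indep n) (hX_bal n) hd0 hd hαn (by omega)
    (fun F j => (Polynomial.X : ℤ[X]) • F j) _
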